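/- Let $A\in\mathbb R^{n\times n}$, $B\in\mathbb R^{n\times p}$, $C\in\mathbb R^{q\times n}$ with $(A,B)$ stabilizable and $(A,C)$ detectable. A matrix is called Schur stable if all its eigenvalues have magnitude less than $1$. Let $\delta$ satisfy one of the following: (a) all eigenvalues of $A$ have magnitude at most $1$, and $0<\delta<1$; or (b) $A$ has at least one eigenvalue of magnitude larger than $1$, $B$ has rank one, and $0<\delta<1/\prod_i|\lambda_i^u(A)|$, where $\lambda_i^u(A)$ are the eigenvalues of $A$ of magnitude larger than $1$, counted with algebraic multiplicity. Then there is a real $K$ such that $A+BK$ is Schur stable, and for every symmetric positive definite $Q$ the modified algebraic Riccati equation $$P=APA^T-(1-\delta^2)\,APC^T(CPC^T+I)^{-1}CPA^T+Q$$ has a unique positive definite solution $P$. For this $P$, for $L=-APC^T(CPC^T+I)^{-1}$, and for every real $K$ such that $A+BK$ is Schur stable, the following hold. 1. The consensus region $\{\sigma\in\mathbb C : A+(1-\sigma)LC \text{ is Schur stable}\}$ contains the closed disk $\{|\sigma|\le\delta\}$. 2. Let $\mathcal G$ be any directed graph without self-loops on $\{1,\dots,N\}$ that contains a directed spanning tree,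 and let $\mathcal D=(d_{ij})$ be a row-stochastic matrix with $d_{ii}>0$ and, for $i\ne j$, $d_{ij}>0$ if $(j,i)$ is an edge and $d_{ij}=0$ otherwise. If all eigenvalues of $\mathcal D$ other than $1$ have magnitude at most $\delta$, then the agents $x_i(k+1)=Ax_i(k)+Bu_i(k)$, $y_i=Cx_i$, $i=1,\dots,N$, under the protocol $$v_i(k+1)=(A+BK)v_i(k)+L\Big(\sum_{j=1}^N d_{ij}C\big(v_i(k)-v_j(k)\big)-\sum_{j=1}^N d_{ij}\big(y_i(k)-y_j(k)\big)\Big),\qquad u_i(k)=Kv_i(k),$$ reach consensus: for all initial states, $\|x_i(k)-x_j(k)\|\to0$ as $k\to\infty$ for all $i,j$. -/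

import Mathlib

open scoped Matrix

namespace DiscreteConsensus

noncomputable section

/-- The complex matrix with the same entries as a real matrix. -/
def cplx {m n : ℕ} (M : Matrix (Fin m) (Fin n) ℝ) : Matrix (Fin m) (Fin n) ℂ :=
  M.map Complex.ofReal

/-- Discrete-time (Schur) stability: all eigenvalues have magnitude less than one. -/
def SchurStable {n : ℕ} (M : Matrix (Fin n) (Fin n) ℂ) : Prop :=
  ∀ μ ∈ spectrum ℂ M, ‖μ‖ < 1

/-- `(A, B)` is stabilizable: some real state feedback makes `A + B K` Schur stable. -/
def Stabilizable {n p : ℕ} (A : Matrix (Fin n) (Fin n) ℝ) (B : Matrix (Fin n) (Fin p) ℝ) : Prop :=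
  ∃ K : Matrix (Fin p) (Fin n) ℝ, SchurStable (cplx (A + B * K))

/-- `(A, C)` is detectable: some real output injection makes `A + F C` Schur stable. -/
def Detectable {n q : ℕ} (A : Matrix (Fin n) (Fin n) ℝ) (C : Matrix (Fin q) (Fin n) ℝ) : Prop :=
  ∃ F : Matrix (Fin n) (Fin q) ℝ, SchurStable (cplx (A + F * C))

open Classical in
/-- The product of the magnitudes of the eigenvalues of `A` outside the closed unit disk,
counted with algebraic multiplicity. -/
def unstableProduct {n : ℕ} (A : Matrix (Fin n) (Fin n) ℝ) : ℝ :=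
  (((cplx A).charpoly.roots.filter (fun μ => 1 < ‖μ‖)).map (fun μ => ‖μ‖)).prod

/-- `P` is a positive definite solution of the modified algebraic Riccati equation
with parameters `δ` and `Q`. -/
def IsMARESolution {n q : ℕ} (A : Matrix (Fin n) (Fin n) ℝ) (C : Matrix (Fin q) (Fin n) ℝ)
    (δ : ℝ) (Q P : Matrix (Fin n) (Fin n) ℝ) : Prop :=
  P.PosDef ∧
    P = A * P * Aᵀ - (1 - δ ^ 2) • (A * P * Cᵀ * (C * P * Cᵀ + 1)⁻¹ * C * P * Aᵀ) + Q

/-- The gain `L = -A P Cᵀ (C P Cᵀ + I)⁻¹`. -/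
def observerGain {n q : ℕ} (A : Matrix (Fin n) (Fin n) ℝ) (C : Matrix (Fin q) (Fin n) ℝ)
    (P : Matrix (Fin n) (Fin n) ℝ) : Matrix (Fin n) (Fin q) ℝ :=
  -(A * P * Cᵀ * (C * P * Cᵀ + 1)⁻¹)

/-- The consensus region: all complex `σ` for which `A + (1 - σ) L C` is Schur stable. -/
def consensusRegion {n q : ℕ} (A : Matrix (Fin n) (Fin n) ℝ) (C : Matrix (Fin q) (Fin n) ℝ)
    (L : Matrix (Fin n) (Fin q) ℝ) : Set ℂ :=
  {σ | SchurStable (cplx A + (1 - σ) • cplx (L * C))}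

/-- `D` is a row-stochastic matrix associated with the directed graph `G`
(an edge `G.Adj j i` means that agent `i` receives information from agent `j`). -/
structure IsRowStochasticFor {N : ℕ} (G : Digraph (Fin N)) (D : Matrix (Fin N) (Fin N) ℝ) :
    Prop where
  diag_pos : ∀ i, 0 < D i i
  edge_pos : ∀ i j, i ≠ j → G.Adj j i → 0 < D i j
  nonedge_zero : ∀ i j, i ≠ j → ¬ G.Adj j i → D i j = 0
  row_sum : ∀ i, ∑ j, D i j = 1

/-- Some root node has a directed path to every node. -/
def HasSpanningTree {N : ℕ} (G : Digraph (Fin N)) : Prop :=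
  ∃ r, ∀ i, Relation.ReflTransGen G.Adj r i

/-- The communication topology `G`, with row-stochastic matrix `D`, belongs to `Γ_{≤ δ}`:
`G` is a directed graph without self-loops that contains a directed spanning tree, and all
eigenvalues of `D` other than `1` lie in the disk of radius `δ` centered at the origin. -/
structure InGammaLe {N : ℕ} (δ : ℝ) (G : Digraph (Fin N)) (D : Matrix (Fin N) (Fin N) ℝ) :
    Prop where
  loopless : ∀ i, ¬ G.Adj i i
  rowStochastic : IsRowStochasticFor G D
  spanningTree : HasSpanningTree G
  eigenvalues : ∀ μ ∈ spectrum ℂ (cplx D), μ ≠ 1 → ‖μ‖ ≤ δ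

/-- `x k i` and `v k i` (agent state and protocol state of agent `i` at time `k`) form a
trajectory of the agents `x⁺ = A x + B u`, `y = C x` under the observer-type protocol
`v⁺ = (A + B K) v + L (∑ⱼ dᵢⱼ C (vᵢ - vⱼ) - ζᵢ)`, `u = K v`, where `ζᵢ = ∑ⱼ dᵢⱼ (yᵢ - yⱼ)`. -/
def IsTrajectory {n p q N : ℕ} (A : Matrix (Fin n) (Fin n) ℝ) (B : Matrix (Fin n) (Fin p) ℝ)
    (C : Matrix (Fin q) (Fin n) ℝ) (K : Matrix (Fin p) (Fin n) ℝ) (L : Matrix (Fin n) (Fin q) ℝ)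
    (D : Matrix (Fin N) (Fin N) ℝ) (x v : ℕ → Fin N → Fin n → ℝ) : Prop :=
  ∀ k i,
    x (k + 1) i = A *ᵥ x k i + B *ᵥ (K *ᵥ v k i) ∧
    v (k + 1) i = (A + B * K) *ᵥ v k i +
      L *ᵥ ((∑ j, D i j • (C *ᵥ (v k i - v k j))) -
        ∑ j, D i j • (C *ᵥ x k i - C *ᵥ x k j))

/-- The protocol with gains `K`, `L` solves the consensus problem: for all initial states,
`‖xᵢ(k) - xⱼ(k)‖ → 0` for all agents `i`, `j`. -/
def SolvesConsensus {n p q N : ℕ} (A : Matrix (Fin n) (Fin n) ℝ) (B : Matrix (Fin n) (Fin p) ℝ)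
    (C : Matrix (Fin q) (Fin n) ℝ) (K : Matrix (Fin p) (Fin n) ℝ) (L : Matrix (Fin n) (Fin q) ℝ)
    (D : Matrix (Fin N) (Fin N) ℝ) : Prop :=
  ∀ x v : ℕ → Fin N → Fin n → ℝ, IsTrajectory A B C K L D x v →
    ∀ i j, Filter.Tendsto (fun k => ‖WithLp.toLp 2 (x k i - x k j)‖) Filter.atTop (nhds 0)

end

end DiscreteConsensus

/-!
Put `ρ = δ ^ 2` and let `Π` be the product of the moduli of the eigenvalues of `A` outside the
closed unit disk. Either alternative on `δ` gives `δ < 1` and `δ * Π < 1`, and `(A, C)` is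
detectable; this is all that the construction of the gain `L` needs.

**The Riccati equation.** The Riccati map is the pointwise minimum over gains `L` of the covariance
propagation `P ↦ ρ A P Aᵀ + (1 - ρ) ((A + L C) P (A + L C)ᵀ + L Lᵀ) + Q` (`gainMap_eq`). Hence it is
monotone, its iterates from zero increase, and they converge to a positive definite fixed point as
soon as they are bounded. They are, if some gain makes the propagation contract in mean square: then
`tr (Y P)` stays bounded for a suitable positive definite `Y` (`exists_mareMap_fixed`). Two fixed
points coincide because the gain belonging to one of them contracts their difference
(`qf_le_of_mareMap_fixed`).

**Mean-square detectability below the threshold.** A gain and a `Y` as above come from any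
`Y > 0`, `β < 1` with `Aᵀ Y A ≤ β H` and `ρ H ≤ Y`, where `H = Y + Cᵀ C`: take
`L = -(1 - ρ)⁻¹ A H⁻¹ Cᵀ` (`exists_meanSquare_contraction`). When all eigenvalues of `A` lie outside
the open unit disk, the Lyapunov equation `Aᴴ Y A = β H` has a positive definite solution, and
taking determinants gives `|det A| ^ 2 det Y = β ^ n det H`. Relative to `Y` the eigenvalues of `H`
are at least one and have product `|det A| ^ 2 / β ^ n`, so each of them is at most `1 / ρ` when
`ρ Π ^ 2 < 1` and `β` is close to one (`exists_form_of_antistable`); no assumption on the rank of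
`C` is needed. In general the space splits into a stable and an antistable part, and the form of the
antistable part is completed by a large multiple of a Lyapunov form of the stable part
(`exists_form_of_detectable`). The splitting is complex; both inequalities are linear in `Y`, so
that the real part of `Y` serves the real pair.

**Consensus.** For `|σ| ≤ δ` the Riccati equation yields
`M P Mᴴ ≤ P - Q < P` with `M = A + (1 - σ) L C`, so `M` is Schur stable
(`closedBall_subset_consensusRegion`). The errors `v i - x i` evolve independently of `K`; a
combination of them along a left generalized eigenvector of `D` for the eigenvalue `σ` obeys
a recursion with matrix `A + (1 - σ) L C`, driven by combinations of lower rank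
(`tendsto_sum_smul_zero`). The spanning tree makes the eigenvalue one of `D` simple, so zero-sum
combinations involve only `|σ| ≤ δ` and decay. The differences `x i - x j` are then driven by a null
sequence through the Schur stable matrix `A + B K`.
-/

namespace DiscreteConsensus

/-! ### Schur stable recursions -/

section Powers

open Filter Topology
open scoped Matrix.Norms.L2Operator ComplexOrder

theorem summable_norm_pow_of_spectralRadius_lt_one {R : Type*} [NormedRing R] [NormedAlgebra ℂ R]
    [CompleteSpace R] {a : R} (h : spectralRadius ℂ a < 1) : Summable fun k : ℕ => ‖a ^ k‖ := by
  obtain ⟨r, hr, hr1⟩ := ENNReal.lt_iff_exists_nnreal_btwn.1 h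
  have hr1 : r < 1 := by exact_mod_cast hr1
  have hev := (spectrum.pow_nnnorm_pow_one_div_tendsto_nhds_spectralRadius a).eventually
    (gt_mem_nhds hr)
  refine Summable.of_norm_bounded_eventually_nat
    (summable_geometric_of_lt_one r.coe_nonneg (by exact_mod_cast hr1 : (r : ℝ) < 1)) ?_
  filter_upwards [hev, eventually_gt_atTop 0] with k hk hk0
  have hk0' : (0 : ℝ) < k := by exact_mod_cast hk0
  have h1 : (‖a ^ k‖₊ : ENNReal) ≤ (r : ENNReal) ^ (k : ℝ) := by
    have := ENNReal.rpow_le_rpow hk.le hk0'.le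
    rwa [← ENNReal.rpow_mul, one_div_mul_cancel hk0'.ne', ENNReal.rpow_one] at this
  rw [ENNReal.rpow_natCast] at h1
  have h2 : ‖a ^ k‖₊ ≤ r ^ k := by exact_mod_cast h1
  rw [norm_norm]
  exact_mod_cast h2

theorem SchurStable.summable_norm_pow {n : ℕ} {M : Matrix (Fin n) (Fin n) ℂ}
    (hM : SchurStable M) : Summable fun k : ℕ => ‖M ^ k‖ := by
  rcases isEmpty_or_nonempty (Fin n) with h | h
  · have : ∀ k : ℕ, ‖M ^ k‖ = 0 := fun k => by
      rw [Subsingleton.elim (M ^ k) 0, norm_zero]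
    simp only [this]
    exact summable_zero
  · refine summable_norm_pow_of_spectralRadius_lt_one ?_
    have := spectrum.spectralRadius_lt_of_forall_lt M (r := 1) (fun k hk => by
      have := hM k hk
      exact_mod_cast this)
    simpa using this

/-- The Cauchy product of a summable sequence and a null sequence tends to zero. Only `j < k` occurs
in the sum, so the truncated subtraction is the true one. -/
theorem tendsto_sum_range_mul_zero {a b : ℕ → ℝ} (ha : Summable a) (ha0 : ∀ k, 0 ≤ a k)
    (hb : Tendsto b atTop (𝓝 0)) :
    Tendsto (fun k => ∑ j ∈ Finset.range k, a j * b (k - 1 - j)) atTop (𝓝 0) := by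
  obtain ⟨c, hc⟩ := (Metric.isBounded_range_of_tendsto b hb).exists_norm_le
  have hc : ∀ k, ‖b k‖ ≤ c := fun k => hc _ ⟨k, rfl⟩
  have key := tendsto_tsum_of_dominated_convergence (𝓕 := atTop)
    (f := fun k j => if j < k then a j * b (k - 1 - j) else 0) (g := fun _ => (0 : ℝ))
    (bound := fun j => a j * c) (ha.mul_right c) (fun j => ?_) (Eventually.of_forall fun k j => ?_)
  · simp only [tsum_zero] at key
    refine key.congr fun k => ?_
    rw [tsum_eq_sum (s := Finset.range k) (fun j hj => if_neg (by simpa using hj))]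
    exact Finset.sum_congr rfl fun j hj => if_pos (Finset.mem_range.1 hj)
  · have : Tendsto (fun k => b (k - 1 - j)) atTop (𝓝 0) :=
      hb.comp ((tendsto_sub_atTop_nat j).comp (tendsto_sub_atTop_nat 1))
    have h2 := this.const_mul (a j)
    rw [mul_zero] at h2
    refine h2.congr' ?_
    filter_upwards [eventually_gt_atTop j] with k hk
    rw [if_pos hk]
  · split_ifs with h
    · rw [norm_mul, Real.norm_of_nonneg (ha0 j)]
      exact mul_le_mul_of_nonneg_left (hc _) (ha0 j)
    · rw [norm_zero]
      exact mul_nonneg (ha0 j) ((norm_nonneg _).trans (hc 0))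

/-- A Schur stable recursion driven by a null sequence tends to zero. -/
theorem SchurStable.tendsto_zero {n : ℕ} {M : Matrix (Fin n) (Fin n) ℂ} (hM : SchurStable M)
    {z f : ℕ → Fin n → ℂ} (hz : ∀ k, z (k + 1) = M *ᵥ z k + f k)
    (hf : Tendsto f atTop (𝓝 0)) : Tendsto z atTop (𝓝 0) := by
  have hs := hM.summable_norm_pow
  set E : (Fin n → ℂ) → EuclideanSpace ℂ (Fin n) := WithLp.toLp 2 with hE
  have hEc : Continuous E := PiLp.continuous_toLp 2 _
  have sol : ∀ k, z k = (M ^ k) *ᵥ z 0 +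
      ∑ j ∈ Finset.range k, (M ^ j) *ᵥ f (k - 1 - j) := by
    intro k
    induction k with
    | zero => simp
    | succ k ih =>
      rw [hz, ih, Finset.sum_range_succ', Matrix.mulVec_add, Matrix.mulVec_mulVec, ← pow_succ',
        Matrix.mulVec_sum, add_assoc]
      simp only [Matrix.mulVec_mulVec, ← pow_succ', pow_zero, Matrix.one_mulVec]
      congr 2
      refine Finset.sum_congr rfl fun j hj => ?_
      congr 2
      have := Finset.mem_range.1 hj
      omega
  have hEf : Tendsto (fun k => ‖E (f k)‖) atTop (𝓝 0) := by
    have := (hEc.tendsto 0).comp hf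
    have h2 := this.norm
    simpa [hE] using h2
  have bound : ∀ k, ‖E (z k)‖ ≤ ‖M ^ k‖ * ‖E (z 0)‖ +
      ∑ j ∈ Finset.range k, ‖M ^ j‖ * ‖E (f (k - 1 - j))‖ := by
    intro k
    have h1 : E (z k) = E ((M ^ k) *ᵥ z 0) +
        ∑ j ∈ Finset.range k, E ((M ^ j) *ᵥ f (k - 1 - j)) := by
      rw [sol k, hE, WithLp.toLp_add, WithLp.toLp_sum]
    rw [h1]
    refine (norm_add_le _ _).trans (add_le_add (Matrix.l2_opNorm_mulVec (M ^ k) (E (z 0))) ?_)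
    exact (norm_sum_le _ _).trans (Finset.sum_le_sum fun j _ =>
      Matrix.l2_opNorm_mulVec (M ^ j) (E (f (k - 1 - j))))
  have lim := (hs.tendsto_atTop_zero.mul_const ‖E (z 0)‖).add
    (tendsto_sum_range_mul_zero hs (fun _ => norm_nonneg _) hEf)
  rw [zero_mul, zero_add] at lim
  have h0 : Tendsto (fun k => E (z k)) atTop (𝓝 0) :=
    squeeze_zero_norm bound lim
  have := ((PiLp.continuous_ofLp 2 (fun _ : Fin n => ℂ)).tendsto 0).comp h0
  simpa [hE, Function.comp_def] using this

/-- The discrete Lyapunov equation `Y = Fᴴ Y F + R`, solved by the series `∑ (Fᴴ)ᵏ R Fᵏ`. -/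
theorem SchurStable.exists_lyapunov {n : ℕ} {F R : Matrix (Fin n) (Fin n) ℂ}
    (hF : SchurStable F) (hR : R.PosSemidef) :
    ∃ Y : Matrix (Fin n) (Fin n) ℂ, Y.PosSemidef ∧ Y = Fᴴ * Y * F + R := by
  have hs := hF.summable_norm_pow
  set t : ℕ → Matrix (Fin n) (Fin n) ℂ := fun k => (F ^ k)ᴴ * R * F ^ k with ht
  have hsum : Summable t := by
    refine Summable.of_norm_bounded_eventually_nat (hs.mul_left ‖R‖) ?_
    filter_upwards [hs.tendsto_atTop_zero.eventually (gt_mem_nhds one_pos)] with k hk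
    calc ‖(F ^ k)ᴴ * R * F ^ k‖ ≤ ‖(F ^ k)ᴴ‖ * ‖R‖ * ‖F ^ k‖ :=
          (norm_mul_le _ _).trans (mul_le_mul_of_nonneg_right (norm_mul_le _ _) (norm_nonneg _))
      _ ≤ 1 * ‖R‖ * ‖F ^ k‖ := by
          rw [Matrix.l2_opNorm_conjTranspose]
          gcongr
      _ = ‖R‖ * ‖F ^ k‖ := by rw [one_mul]
  have hY := hsum.hasSum
  set Y := ∑' k, t k
  have hstep : ∀ k, t (k + 1) = Fᴴ * t k * F := fun k => by
    simp only [ht, pow_succ, Matrix.conjTranspose_mul, Matrix.mul_assoc]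
  have hpos : ∀ k, (t k).PosSemidef := fun k => hR.conjTranspose_mul_mul_same _
  refine ⟨Y, Matrix.PosSemidef.of_dotProduct_mulVec_nonneg ?_ fun x => ?_, ?_⟩
  · have h1 : HasSum (fun k => (t k)ᴴ) Yᴴ := hY.matrix_conjTranspose
    simp only [fun k => (hpos k).isHermitian.eq] at h1
    exact h1.unique hY
  · have hc : Continuous fun M : Matrix (Fin n) (Fin n) ℂ => star x ⬝ᵥ (M *ᵥ x) := by
      fun_prop
    have h1 := ((hc.tendsto Y).comp hY.tendsto_sum_nat)
    refine ge_of_tendsto' h1 fun k => ?_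
    exact (Matrix.posSemidef_sum _ fun i _ => hpos i).dotProduct_mulVec_nonneg x
  · have h1 : HasSum (fun k => t (k + 1)) (Fᴴ * Y * F) := by
      simp only [hstep]
      exact (hY.mul_left _).mul_right _
    have h2 := (hasSum_nat_add_iff 1).1 h1
    have := hY.unique h2
    simpa [ht] using this

end Powers

/-! ### Hermitian forms -/

section QuadraticForms

open scoped ComplexOrder

variable {𝕜 m n : Type*} [RCLike 𝕜] [Fintype m] [Fintype n]

/-- The real number `Re (x* M x)`, the value at `x` of the Hermitian form with matrix `M`. -/
noncomputable def qf (M : Matrix n n 𝕜) (x : n → 𝕜) : ℝ := RCLike.re (star x ⬝ᵥ (M *ᵥ x))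

/-- The squared Euclidean norm of a coordinate vector. -/
noncomputable def nsq (x : n → 𝕜) : ℝ := RCLike.re (star x ⬝ᵥ x)

theorem nsq_eq_sum (x : n → 𝕜) : nsq x = ∑ i, ‖x i‖ ^ 2 := by
  simp only [nsq, dotProduct, Pi.star_apply, map_sum]
  refine Finset.sum_congr rfl fun i _ => ?_
  rw [RCLike.star_def, RCLike.conj_mul, ← RCLike.ofReal_pow, RCLike.ofReal_re]

theorem nsq_nonneg (x : n → 𝕜) : 0 ≤ nsq x := by
  rw [nsq_eq_sum]
  positivity

theorem nsq_pos {x : n → 𝕜} (hx : x ≠ 0) : 0 < nsq x := by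
  rw [nsq_eq_sum]
  obtain ⟨i, hi⟩ := Function.ne_iff.1 hx
  exact Finset.sum_pos' (fun _ _ => by positivity)
    ⟨i, Finset.mem_univ _, by have := norm_pos_iff.2 hi; positivity⟩

/-- Young's inequality for the squared Euclidean norm. -/
theorem nsq_add_le {ε : ℝ} (hε : 0 < ε) (x y : n → 𝕜) :
    nsq (x + y) ≤ (1 + ε) * nsq x + (1 + 1 / ε) * nsq y := by
  simp only [nsq_eq_sum, Finset.mul_sum, ← Finset.sum_add_distrib]
  refine Finset.sum_le_sum fun i _ => ?_
  have h1 : ‖(x + y) i‖ ^ 2 ≤ (‖x i‖ + ‖y i‖) ^ 2 :=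
    pow_le_pow_left₀ (norm_nonneg _) (norm_add_le _ _) 2
  have h2 : 0 ≤ (1 / ε) * (ε * ‖x i‖ - ‖y i‖) ^ 2 := by positivity
  have h3 : (1 / ε) * (ε * ‖x i‖ - ‖y i‖) ^ 2 =
      ε * ‖x i‖ ^ 2 - 2 * (‖x i‖ * ‖y i‖) + 1 / ε * ‖y i‖ ^ 2 := by
    field_simp
    ring
  nlinarith [h1, h2, h3]

theorem nsq_neg (x : n → 𝕜) : nsq (-x) = nsq x := by simp [nsq_eq_sum]

theorem qf_add (M N : Matrix n n 𝕜) (x : n → 𝕜) : qf (M + N) x = qf M x + qf N x := by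
  simp [qf, Matrix.add_mulVec]

theorem qf_sub (M N : Matrix n n 𝕜) (x : n → 𝕜) : qf (M - N) x = qf M x - qf N x := by
  simp [qf, Matrix.sub_mulVec]

theorem qf_smul (r : ℝ) (M : Matrix n n 𝕜) (x : n → 𝕜) : qf (r • M) x = r * qf M x := by
  simp [qf, Matrix.smul_mulVec, RCLike.smul_re]

theorem qf_one [DecidableEq n] (x : n → 𝕜) : qf (1 : Matrix n n 𝕜) x = nsq x := by
  simp [qf, nsq]

/-- The form of a congruence `Tᴴ M T` is the form of `M` composed with `T`. -/
theorem qf_conj (T : Matrix m n 𝕜) (M : Matrix m m 𝕜) (x : n → 𝕜) :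
    qf (Tᴴ * M * T) x = qf M (T *ᵥ x) := by
  rw [qf, qf, Matrix.star_mulVec, ← Matrix.mulVec_mulVec, ← Matrix.mulVec_mulVec,
    Matrix.dotProduct_mulVec (star x), Matrix.dotProduct_mulVec]

theorem qf_gram (T : Matrix m n 𝕜) (x : n → 𝕜) : qf (Tᴴ * T) x = nsq (T *ᵥ x) := by
  rw [qf, nsq, Matrix.star_mulVec, ← Matrix.mulVec_mulVec, Matrix.dotProduct_mulVec]

theorem qf_smul_vec (M : Matrix n n 𝕜) (c : 𝕜) (x : n → 𝕜) :
    qf M (c • x) = ‖c‖ ^ 2 * qf M x := by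
  rw [qf, qf, Matrix.mulVec_smul, star_smul, smul_dotProduct, dotProduct_smul, smul_smul,
    RCLike.star_def, RCLike.conj_mul, ← RCLike.ofReal_pow, smul_eq_mul, RCLike.re_ofReal_mul]

theorem qf_zero_vec (M : Matrix n n 𝕜) : qf M 0 = 0 := by simp [qf]

theorem continuous_qf (M : Matrix n n 𝕜) : Continuous (qf M) := by
  unfold qf
  fun_prop

theorem qf_nonneg {M : Matrix n n 𝕜} (hM : M.PosSemidef) (x : n → 𝕜) : 0 ≤ qf M x :=
  hM.re_dotProduct_nonneg x

theorem qf_pos {M : Matrix n n 𝕜} (hM : M.PosDef) {x : n → 𝕜} (hx : x ≠ 0) : 0 < qf M x :=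
  hM.re_dotProduct_pos hx

theorem coe_qf {M : Matrix n n 𝕜} (hM : M.IsHermitian) (x : n → 𝕜) :
    (qf M x : 𝕜) = star x ⬝ᵥ (M *ᵥ x) := by
  rw [qf]
  refine RCLike.conj_eq_iff_re.1 ?_
  rw [← RCLike.star_def, ← Matrix.star_dotProduct, Matrix.star_mulVec, hM.eq,
    Matrix.dotProduct_mulVec]

theorem posSemidef_of_qf_nonneg {M : Matrix n n 𝕜} (hM : M.IsHermitian)
    (h : ∀ x, 0 ≤ qf M x) : M.PosSemidef :=
  .of_dotProduct_mulVec_nonneg hM fun x => by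
    rw [← coe_qf hM]
    exact_mod_cast h x

theorem posDef_of_qf_pos {M : Matrix n n 𝕜} (hM : M.IsHermitian)
    (h : ∀ x, x ≠ 0 → 0 < qf M x) : M.PosDef :=
  .of_dotProduct_mulVec_pos hM fun x hx => by
    rw [← coe_qf hM]
    exact_mod_cast h x hx

/-- Any form is dominated by a multiple of a positive definite one. -/
theorem exists_qf_le_mul {Y : Matrix n n 𝕜} (hY : ∀ x, x ≠ 0 → 0 < qf Y x) (N : Matrix n n 𝕜) :
    ∃ c : ℝ, 0 < c ∧ ∀ x, qf N x ≤ c * qf Y x := by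
  have hcont : ContinuousOn (fun x => qf N x / qf Y x) (Metric.sphere (0 : n → 𝕜) 1) :=
    ((continuous_qf N).continuousOn).div ((continuous_qf Y).continuousOn) fun x hx =>
      (hY x (ne_zero_of_mem_unit_sphere ⟨x, hx⟩)).ne'
  obtain ⟨c, hc⟩ := ((isCompact_sphere (0 : n → 𝕜) 1).image_of_continuousOn hcont).bddAbove
  refine ⟨max c 1, by positivity, fun x => ?_⟩
  by_cases hx : x = 0
  · simp [hx, qf_zero_vec]
  have hxn : 0 < ‖x‖ := norm_pos_iff.2 hx
  have hux : x = ((‖x‖ : ℝ) : 𝕜) • (((‖x‖⁻¹ : ℝ) : 𝕜) • x) := by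
    rw [smul_smul, ← RCLike.ofReal_mul, mul_inv_cancel₀ hxn.ne', RCLike.ofReal_one, one_smul]
  set u := ((‖x‖⁻¹ : ℝ) : 𝕜) • x with hu
  have hun : ‖u‖ = 1 := by
    rw [hu, norm_smul, RCLike.norm_ofReal, abs_of_pos (by positivity), inv_mul_cancel₀ hxn.ne']
  have hu0 : u ≠ 0 := fun h => by simp [h] at hun
  have h1 : qf N u / qf Y u ≤ c := hc ⟨u, by simpa using hun, rfl⟩
  rw [div_le_iff₀ (hY u hu0)] at h1
  have h2 : qf N u ≤ max c 1 * qf Y u :=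
    h1.trans (mul_le_mul_of_nonneg_right (le_max_left _ _) (hY u hu0).le)
  have hN := qf_smul_vec N ((‖x‖ : ℝ) : 𝕜) u
  have hY' := qf_smul_vec Y ((‖x‖ : ℝ) : 𝕜) u
  rw [← hux] at hN hY'
  rw [hN, hY', mul_left_comm]
  exact mul_le_mul_of_nonneg_left h2 (by positivity)

/-- A form strictly below a nonnegative one is below a proper fraction of it. -/
theorem exists_qf_le_contraction {Y N : Matrix n n 𝕜} (hY : ∀ x, 0 ≤ qf Y x)
    (hN : ∀ x, x ≠ 0 → qf N x < qf Y x) :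
    ∃ c : ℝ, 0 < c ∧ c < 1 ∧ ∀ x, qf N x ≤ c * qf Y x := by
  obtain ⟨K, hK, h⟩ := exists_qf_le_mul (Y := Y - N)
    (fun x hx => by rw [qf_sub]; exact sub_pos.2 (hN x hx)) Y
  have hK1 : 0 < K + 1 := by linarith
  refine ⟨1 - 1 / (K + 1), ?_, ?_, fun x => ?_⟩
  · rw [sub_pos, div_lt_one hK1]
    linarith
  · rw [sub_lt_self_iff]
    positivity
  · have h1 := h x
    have h2 := hY x
    rw [qf_sub] at h1
    have h3 : qf N x ≤ qf Y x - qf Y x / (K + 1) := by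
      rw [le_sub_iff_add_le, ← le_sub_iff_add_le', div_le_iff₀ hK1]
      nlinarith [h1, h2]
    calc qf N x ≤ _ := h3
      _ = _ := by ring

end QuadraticForms

/-! ### Eigenvectors and definite forms -/

section Eigenvectors

open scoped ComplexOrder

variable {n : Type*} [Fintype n] [DecidableEq n]

theorem mem_spectrum_iff_exists_eigenvector {M : Matrix n n ℂ} {μ : ℂ} :
    μ ∈ spectrum ℂ M ↔ ∃ x, x ≠ 0 ∧ M *ᵥ x = μ • x := by
  rw [← Matrix.spectrum_toLin', ← Module.End.hasEigenvalue_iff_mem_spectrum]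
  constructor
  · intro h
    obtain ⟨x, hx⟩ := h.exists_hasEigenvector
    exact ⟨x, hx.2, by simpa using hx.apply_eq_smul⟩
  · rintro ⟨x, hx, h⟩
    exact Module.End.hasEigenvalue_of_hasEigenvector
      ⟨Module.End.mem_eigenspace_iff.2 (by simpa using h), hx⟩

/-- Lyapunov criterion, tested on left eigenvectors of `M`. -/
theorem schurStable_of_qf_lt {n : ℕ} {M X : Matrix (Fin n) (Fin n) ℂ}
    (hX : ∀ x, 0 ≤ qf X x) (h : ∀ x, x ≠ 0 → qf (M * X * Mᴴ) x < qf X x) : SchurStable M := by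
  intro μ hμ
  have hμ' : star μ ∈ spectrum ℂ Mᴴ := by
    rw [← Matrix.star_eq_conjTranspose, spectrum.map_star]
    simpa using hμ
  obtain ⟨x, hx, hxe⟩ := mem_spectrum_iff_exists_eigenvector.1 hμ'
  have h1 := h x hx
  have h2 := qf_conj Mᴴ X x
  rw [Matrix.conjTranspose_conjTranspose] at h2
  rw [h2, hxe, qf_smul_vec, norm_star] at h1
  by_contra hc
  nlinarith [hX x, mul_self_nonneg (‖μ‖ - 1), norm_nonneg μ]

/-- If `Y ≤ H` and `ρ det H ≤ det Y`, then `ρ H ≤ Y`: relative to `Y`, all eigenvalues of `H` are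
at least one, so each of them is at most their product `det H / det Y`. -/
theorem mul_qf_le_of_mul_det_le {Y H : Matrix n n ℂ} (hY : Y.PosDef) (hYH : (H - Y).PosSemidef)
    {ρ : ℝ} (hρ : 0 < ρ) (hdet : ρ * ‖H.det‖ ≤ ‖Y.det‖) (x : n → ℂ) :
    ρ * qf H x ≤ qf Y x := by
  open scoped MatrixOrder in
  obtain ⟨S, hS, hSh⟩ : ∃ S : Matrix n n ℂ, S * S = Y ∧ Sᴴ = S :=
    ⟨CFC.sqrt Y, CFC.sqrt_mul_sqrt_self Y (Matrix.nonneg_iff_posSemidef.2 hY.posSemidef),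
      (Matrix.nonneg_iff_posSemidef.1 (CFC.sqrt_nonneg Y)).isHermitian.eq⟩
  have hdS : S.det * S.det = Y.det := by rw [← Matrix.det_mul, hS]
  have hdY : Y.det ≠ 0 := hY.det_pos.ne'
  have hdS0 : S.det ≠ 0 := fun h => hdY (by rw [← hdS, h, zero_mul])
  have hSu : IsUnit S.det := isUnit_iff_ne_zero.2 hdS0
  have hTh : (S⁻¹)ᴴ = S⁻¹ := by rw [Matrix.conjTranspose_nonsing_inv, hSh]
  set M := (S⁻¹)ᴴ * H * S⁻¹ with hM
  have hH : M = (S⁻¹)ᴴ * (H - Y) * S⁻¹ + 1 := by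
    rw [hM, Matrix.mul_sub, Matrix.sub_mul, ← hS, hTh]
    rw [← Matrix.mul_assoc S⁻¹ S S, Matrix.nonsing_inv_mul _ hSu, Matrix.one_mul,
      Matrix.mul_nonsing_inv _ hSu, sub_add_cancel]
  have hM1 : (M - 1).PosSemidef := by
    rw [hH, add_sub_cancel_right]
    exact hYH.conjTranspose_mul_mul_same _
  have hMh : M.IsHermitian := by
    have := hM1.isHermitian.add Matrix.isHermitian_one
    rwa [sub_add_cancel] at this
  have hge : ∀ i, 1 ≤ hMh.eigenvalues i := fun i => by
    have h1 := qf_nonneg hM1 (hMh.eigenvectorBasis i).ofLp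
    have hne : (hMh.eigenvectorBasis i).ofLp ≠ 0 := fun h =>
      hMh.eigenvectorBasis.orthonormal.ne_zero i ((WithLp.ofLp_eq_zero 2).1 h)
    have h2 : qf M (hMh.eigenvectorBasis i).ofLp =
        hMh.eigenvalues i * nsq (hMh.eigenvectorBasis i).ofLp := by
      rw [qf, hMh.mulVec_eigenvectorBasis, dotProduct_smul, RCLike.smul_re, nsq]
    rw [qf_sub, qf_one, h2] at h1
    by_contra hc
    nlinarith [nsq_pos hne]
  have hle : ∀ i, hMh.eigenvalues i ≤ 1 / ρ := fun i => by
    have h1 : hMh.eigenvalues i ≤ ∏ j, hMh.eigenvalues j := by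
      rw [← Finset.mul_prod_erase _ _ (Finset.mem_univ i)]
      exact le_mul_of_one_le_right (zero_le_one.trans (hge i))
        (Finset.one_le_prod fun j _ => hge j)
    have h2 : ‖M.det‖ = ∏ j, hMh.eigenvalues j := by
      rw [hMh.det_eq_prod_eigenvalues, ← RCLike.ofReal_prod, RCLike.norm_ofReal,
        abs_of_nonneg (Finset.prod_nonneg fun j _ => zero_le_one.trans (hge j))]
    have h3 : M.det * Y.det = H.det := by
      rw [hM, hTh, Matrix.det_mul, Matrix.det_mul, ← hdS]
      have : S⁻¹.det * S.det = 1 := by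
        rw [← Matrix.det_mul, Matrix.nonsing_inv_mul _ hSu, Matrix.det_one]
      linear_combination H.det * (S⁻¹.det * S.det + 1) * this
    have h4 : ‖M.det‖ * ‖Y.det‖ = ‖H.det‖ := by rw [← norm_mul, h3]
    rw [← h4] at hdet
    have h5 : 0 < ‖Y.det‖ := norm_pos_iff.2 hdY
    have h6 : ρ * ‖M.det‖ ≤ 1 := by
      by_contra hc
      nlinarith
    rw [le_div_iff₀ hρ]
    nlinarith
  have hfin : ((1 / ρ) • (1 : Matrix n n ℂ) - M).PosSemidef := by
    have hherm : ((1 / ρ) • (1 : Matrix n n ℂ) - M).IsHermitian :=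
      (Matrix.isHermitian_one.smul (IsSelfAdjoint.all _)).sub hMh
    refine Matrix.posSemidef_iff_isHermitian_and_spectrum_nonneg.2 ⟨hherm, fun a ha => ?_⟩
    rw [← Algebra.algebraMap_eq_smul_one,
      IsScalarTower.algebraMap_apply ℝ ℂ (Matrix n n ℂ), ← spectrum.singleton_sub_eq] at ha
    obtain ⟨b, hb, c, hc, rfl⟩ := Set.mem_sub.1 ha
    rw [hMh.spectrum_eq_image_range] at hc
    obtain ⟨_, ⟨i, rfl⟩, rfl⟩ := hc
    rw [Set.mem_singleton_iff.1 hb]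
    have := sub_nonneg.2 (hle i)
    have h0 : (0 : ℂ) ≤ ((1 / ρ - hMh.eigenvalues i : ℝ) : ℂ) := RCLike.ofReal_nonneg.2 this
    rw [Complex.ofReal_sub] at h0
    exact h0
  have hx := qf_nonneg hfin (S *ᵥ x)
  rw [qf_sub, qf_smul, qf_one, ← qf_conj S M x, ← qf_gram S x, hM, hSh, hTh, hS] at hx
  have hSM : S * (S⁻¹ * H * S⁻¹) * S = H := by
    rw [Matrix.mul_assoc S⁻¹ H, ← Matrix.mul_assoc S S⁻¹, Matrix.mul_nonsing_inv _ hSu,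
      Matrix.one_mul, Matrix.mul_assoc, Matrix.nonsing_inv_mul _ hSu, Matrix.mul_one]
  rw [hSM] at hx
  calc ρ * qf H x ≤ ρ * (1 / ρ * qf Y x) := by gcongr; linarith
    _ = qf Y x := by field_simp

end Eigenvectors

/-! ### Splitting off the stable part of a matrix -/

section SpectralSplitting

open Polynomial

/-- Splitting of a finite-dimensional space along the kernels of two coprime factors of the
characteristic polynomial, in coordinates. -/
theorem exists_equiv_conj_eq_prodMap {V : Type*} [AddCommGroup V] [Module ℂ V]
    [FiniteDimensional ℂ V] (f : Module.End ℂ V) {p q : ℂ[X]} (hpq : IsCoprime p q)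
    (h : f.charpoly = p * q) :
    ∃ (a b : ℕ) (e : V ≃ₗ[ℂ] (Fin a → ℂ) × (Fin b → ℂ)) (g₁ : Module.End ℂ (Fin a → ℂ))
      (g₂ : Module.End ℂ (Fin b → ℂ)), (∀ x, e (f x) = (g₁ (e x).1, g₂ (e x).2)) ∧
      (∀ μ, g₁.HasEigenvalue μ → p.eval μ = 0) ∧ (∀ μ, g₂.HasEigenvalue μ → q.eval μ = 0) := by
  have hcompl : IsCompl (LinearMap.ker (aeval f p)) (LinearMap.ker (aeval f q)) := by
    refine ⟨disjoint_ker_aeval_of_isCoprime f hpq, codisjoint_iff.2 ?_⟩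
    rw [sup_ker_aeval_eq_ker_aeval_mul_of_coprime f hpq, ← h, f.aeval_self_charpoly,
      LinearMap.ker_zero]
  have hinv : ∀ (r : ℂ[X]) (x : V), x ∈ LinearMap.ker (aeval f r) →
      f x ∈ LinearMap.ker (aeval f r) := fun r x hx => by
    rw [LinearMap.mem_ker] at hx ⊢
    have hcomm : aeval f r * f = f * aeval f r := by
      have h1 := congrArg (aeval f) (mul_comm r X)
      rwa [map_mul, map_mul, aeval_X] at h1
    rw [← Module.End.mul_apply, hcomm, Module.End.mul_apply, hx, map_zero]
  set E₁ := LinearMap.ker (aeval f p)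
  set E₂ := LinearMap.ker (aeval f q)
  let f₁ : Module.End ℂ E₁ := f.restrict (hinv p)
  let f₂ : Module.End ℂ E₂ := f.restrict (hinv q)
  let c₁ := (Module.finBasis ℂ E₁).equivFun
  let c₂ := (Module.finBasis ℂ E₂).equivFun
  let s := E₁.prodEquivOfIsCompl E₂ hcompl
  have hroot : ∀ (r : ℂ[X]) (c : LinearMap.ker (aeval f r) ≃ₗ[ℂ]
      (Fin (Module.finrank ℂ (LinearMap.ker (aeval f r))) → ℂ)) (μ : ℂ),
      Module.End.HasEigenvalue (c.conj (f.restrict (hinv r))) μ → r.eval μ = 0 := by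
    intro r c μ hμ
    obtain ⟨x, hx⟩ := hμ.exists_hasEigenvector
    have h1 := hx.apply_eq_smul
    rw [LinearEquiv.conj_apply_apply, ← LinearEquiv.eq_symm_apply, map_smul] at h1
    have h2 : f (c.symm x : V) = μ • (c.symm x : V) := congrArg Subtype.val h1
    have h3 : (c.symm x : V) ≠ 0 := fun h0 =>
      hx.2 (c.symm.map_eq_zero_iff.1 (Subtype.ext h0))
    have h4 := Module.End.aeval_apply_of_hasEigenvector (p := r)
      ⟨Module.End.mem_eigenspace_iff.2 h2, h3⟩
    rw [LinearMap.mem_ker.1 (c.symm x).2] at h4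
    exact (smul_eq_zero.1 h4.symm).resolve_right h3
  refine ⟨_, _, s.symm.trans (c₁.prodCongr c₂), c₁.conj f₁, c₂.conj f₂, fun x => ?_,
    hroot p c₁, hroot q c₂⟩
  obtain ⟨⟨y, z⟩, rfl⟩ := s.surjective x
  have h1 : f (s (y, z)) = s (f₁ y, f₂ z) := by
    simp [s, f₁, f₂]
  simp [h1, LinearEquiv.conj_apply_apply]

/-- A complex matrix is block diagonal in suitable coordinates, one block having its eigenvalues in
the open unit disk and the other one outside. The coordinates are `(Ts, Tu)`, and
`Rs`, `Ru` are the inclusions of the two summands. -/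
theorem exists_spectral_splitting {n : ℕ} (A : Matrix (Fin n) (Fin n) ℂ) :
    ∃ (a b : ℕ) (As : Matrix (Fin a) (Fin a) ℂ) (Au : Matrix (Fin b) (Fin b) ℂ)
      (Ts : Matrix (Fin a) (Fin n) ℂ) (Tu : Matrix (Fin b) (Fin n) ℂ)
      (Rs : Matrix (Fin n) (Fin a) ℂ) (Ru : Matrix (Fin n) (Fin b) ℂ),
      Ts * A = As * Ts ∧ Tu * A = Au * Tu ∧ A * Ru = Ru * Au ∧ Rs * Ts + Ru * Tu = 1 ∧
      Tu * Ru = 1 ∧ SchurStable As ∧ (∀ μ ∈ spectrum ℂ Au, 1 ≤ ‖μ‖) ∧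
      A.charpoly = As.charpoly * Au.charpoly := by
  classical
  set r := A.charpoly.roots with hr
  set p : ℂ[X] := ((r.filter fun μ => ‖μ‖ < 1).map fun μ => X - C μ).prod with hp
  set q : ℂ[X] := ((r.filter fun μ => ¬ ‖μ‖ < 1).map fun μ => X - C μ).prod with hq
  have hpq : A.toLin'.charpoly = p * q := by
    rw [Matrix.charpoly_toLin', hp, hq, ← Multiset.prod_add, ← Multiset.map_add,
      Multiset.filter_add_not, hr]
    exact (IsAlgClosed.splits _).eq_prod_roots_of_monic A.charpoly_monic
  have heval : ∀ (t : Multiset ℂ) (μ : ℂ), ((t.map fun μ => X - C μ).prod : ℂ[X]).eval μ = 0 →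
      μ ∈ t := fun t μ h => by
    rw [eval_multiset_prod, Multiset.map_map, Multiset.prod_eq_zero_iff] at h
    obtain ⟨ν, hν, h⟩ := Multiset.mem_map.1 h
    simp only [Function.comp_apply, eval_sub, eval_X, eval_C, sub_eq_zero] at h
    rwa [h]
  have hp0 : ∀ μ, p.eval μ = 0 → ‖μ‖ < 1 := fun μ h => (Multiset.mem_filter.1 (heval _ μ h)).2
  have hq0 : ∀ μ, q.eval μ = 0 → 1 ≤ ‖μ‖ := fun μ h =>
    not_lt.1 (Multiset.mem_filter.1 (heval _ μ h)).2
  have hcop : IsCoprime p q := by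
    refine (isCoprime_iff_aeval_ne_zero_of_isAlgClosed ℂ ℂ p q).2 fun μ => ?_
    by_contra! hc
    exact absurd (hp0 μ (by simpa using hc.1)) (not_lt.2 (hq0 μ (by simpa using hc.2)))
  obtain ⟨a, b, e, g₁, g₂, he, h₁, h₂⟩ := exists_equiv_conj_eq_prodMap A.toLin' hcop hpq
  have hA : A = LinearMap.toMatrix' A.toLin' := (LinearMap.toMatrix'_toLin' A).symm
  have hesymm : ∀ y, A.toLin' (e.symm y) = e.symm (g₁ y.1, g₂ y.2) := fun y => by
    rw [LinearEquiv.eq_symm_apply, he, LinearEquiv.apply_symm_apply]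
  refine ⟨a, b, LinearMap.toMatrix' g₁, LinearMap.toMatrix' g₂,
    LinearMap.toMatrix' (LinearMap.fst ℂ _ _ ∘ₗ e.toLinearMap),
    LinearMap.toMatrix' (LinearMap.snd ℂ _ _ ∘ₗ e.toLinearMap),
    LinearMap.toMatrix' (e.symm.toLinearMap ∘ₗ LinearMap.inl ℂ _ _),
    LinearMap.toMatrix' (e.symm.toLinearMap ∘ₗ LinearMap.inr ℂ _ _), ?_, ?_, ?_, ?_, ?_, ?_, ?_, ?_⟩
  · conv_lhs => rw [hA]
    rw [← LinearMap.toMatrix'_comp, ← LinearMap.toMatrix'_comp]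
    congr 1
    refine LinearMap.ext fun x => ?_
    simp only [LinearMap.comp_apply, LinearEquiv.coe_coe, he, LinearMap.fst_apply]
  · conv_lhs => rw [hA]
    rw [← LinearMap.toMatrix'_comp, ← LinearMap.toMatrix'_comp]
    congr 1
    refine LinearMap.ext fun x => ?_
    simp only [LinearMap.comp_apply, LinearEquiv.coe_coe, he, LinearMap.snd_apply]
  · conv_lhs => rw [hA]
    rw [← LinearMap.toMatrix'_comp, ← LinearMap.toMatrix'_comp]
    congr 1
    refine LinearMap.ext fun x => ?_
    simp only [LinearMap.comp_apply, LinearEquiv.coe_coe, hesymm, LinearMap.inr_apply, map_zero]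
  · rw [← LinearMap.toMatrix'_comp, ← LinearMap.toMatrix'_comp, ← map_add, ← LinearMap.toMatrix'_id]
    congr 1
    refine LinearMap.ext fun x => ?_
    simp only [LinearMap.comp_apply, LinearEquiv.coe_coe, LinearMap.add_apply, LinearMap.fst_apply,
      LinearMap.snd_apply, LinearMap.inl_apply, LinearMap.inr_apply, ← map_add, LinearMap.id_apply]
    rw [LinearEquiv.symm_apply_eq]
    simp
  · rw [← LinearMap.toMatrix'_comp, ← LinearMap.toMatrix'_id]
    congr 1
    refine LinearMap.ext fun x => ?_
    simp
  · intro μ hμ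
    rw [← Matrix.spectrum_toLin', Matrix.toLin'_toMatrix',
      ← Module.End.hasEigenvalue_iff_mem_spectrum] at hμ
    exact hp0 μ (h₁ μ hμ)
  · intro μ hμ
    rw [← Matrix.spectrum_toLin', Matrix.toLin'_toMatrix',
      ← Module.End.hasEigenvalue_iff_mem_spectrum] at hμ
    exact hq0 μ (h₂ μ hμ)
  · have hconj : e.conj A.toLin' = g₁.prodMap g₂ := LinearMap.ext fun y => by
      rw [LinearEquiv.conj_apply_apply, he, LinearEquiv.apply_symm_apply]
      rfl
    rw [← Matrix.charpoly_toLin' A, ← LinearEquiv.charpoly_conj e, hconj,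
      LinearMap.charpoly_prodMap, ← Matrix.charpoly_toLin', ← Matrix.charpoly_toLin',
      Matrix.toLin'_toMatrix', Matrix.toLin'_toMatrix']

end SpectralSplitting

/-! ### The unstable product -/

section UnstableProduct

open Polynomial

/-- The anti-stable block of a splitting has determinant of modulus `unstableProduct A`:
eigenvalues in the open disk do not enter, and those on the circle contribute a factor one. -/
theorem norm_det_eq_unstableProduct {n a b : ℕ} {A : Matrix (Fin n) (Fin n) ℝ}
    {As : Matrix (Fin a) (Fin a) ℂ} {Au : Matrix (Fin b) (Fin b) ℂ} (hs : SchurStable As)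
    (hu : ∀ μ ∈ spectrum ℂ Au, 1 ≤ ‖μ‖) (h : (cplx A).charpoly = As.charpoly * Au.charpoly) :
    ‖Au.det‖ = unstableProduct A := by
  classical
  have hs' : ∀ μ ∈ As.charpoly.roots, ‖μ‖ < 1 := fun μ hμ =>
    hs μ (Matrix.mem_spectrum_iff_isRoot_charpoly.2 (isRoot_of_mem_roots hμ))
  have hu' : ∀ μ ∈ Au.charpoly.roots, 1 ≤ ‖μ‖ := fun μ hμ =>
    hu μ (Matrix.mem_spectrum_iff_isRoot_charpoly.2 (isRoot_of_mem_roots hμ))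
  have hne : As.charpoly * Au.charpoly ≠ 0 :=
    mul_ne_zero As.charpoly_monic.ne_zero Au.charpoly_monic.ne_zero
  have key : ∀ s : Multiset ℂ, (∀ μ ∈ s, 1 ≤ ‖μ‖) →
      ‖s.prod‖ = ((s.filter fun μ => 1 < ‖μ‖).map fun μ => ‖μ‖).prod := by
    intro s
    induction s using Multiset.induction_on with
    | empty => simp
    | cons μ s ih =>
      intro hs
      have h1 := hs μ (Multiset.mem_cons_self _ _)
      have h2 := ih fun ν hν => hs ν (Multiset.mem_cons_of_mem hν)
      rw [Multiset.prod_cons, norm_mul, h2]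
      rcases h1.eq_or_lt with h1 | h1
      · rw [Multiset.filter_cons_of_neg _ (by simp [← h1]), ← h1, one_mul]
      · rw [Multiset.filter_cons_of_pos (p := fun μ : ℂ => 1 < ‖μ‖) _ h1, Multiset.map_cons,
          Multiset.prod_cons]
  have h0 : As.charpoly.roots.filter (fun μ => 1 < ‖μ‖) = 0 :=
    Multiset.filter_eq_nil.2 fun μ hμ => (hs' μ hμ).le.not_gt
  rw [Matrix.det_eq_prod_roots_charpoly, key _ hu', unstableProduct, h, roots_mul hne,
    Multiset.filter_add, h0, zero_add]

theorem one_le_unstableProduct {n : ℕ} (A : Matrix (Fin n) (Fin n) ℝ) :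
    1 ≤ unstableProduct A := by
  classical
  unfold unstableProduct
  refine Multiset.one_le_prod_map fun μ hμ => ?_
  exact (Multiset.mem_filter.1 hμ).2.le

theorem unstableProduct_eq_one {n : ℕ} {A : Matrix (Fin n) (Fin n) ℝ}
    (h : ∀ μ ∈ spectrum ℂ (cplx A), ‖μ‖ ≤ 1) : unstableProduct A = 1 := by
  classical
  unfold unstableProduct
  rw [Multiset.filter_eq_nil.2, Multiset.map_zero, Multiset.prod_zero]
  exact fun μ hμ => (h μ (Matrix.mem_spectrum_iff_isRoot_charpoly.2
    (Polynomial.isRoot_of_mem_roots hμ))).not_gt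

end UnstableProduct

/-! ### Lyapunov forms for detectable pairs -/

section LyapunovForms

open scoped ComplexOrder

theorem eq_zero_of_nsq_eq_zero {𝕜 n : Type*} [RCLike 𝕜] [Fintype n] {x : n → 𝕜}
    (h : nsq x = 0) : x = 0 := by
  by_contra hx
  exact (nsq_pos hx).ne' h

theorem SchurStable.exists_contracting_form {n : ℕ} {F : Matrix (Fin n) (Fin n) ℂ}
    (hF : SchurStable F) : ∃ Y : Matrix (Fin n) (Fin n) ℂ, Y.PosDef ∧
      ∃ c : ℝ, 0 < c ∧ c < 1 ∧ ∀ x, qf Y (F *ᵥ x) ≤ c * qf Y x := by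
  obtain ⟨Y, hY, h⟩ := hF.exists_lyapunov Matrix.PosSemidef.one
  have hq : ∀ x, qf Y x = qf (Fᴴ * Y * F) x + nsq x := fun x => by
    conv_lhs => rw [h]
    rw [qf_add, qf_one]
  have hYd : Y.PosDef := posDef_of_qf_pos hY.isHermitian fun x hx => by
    rw [hq, qf_conj]
    exact add_pos_of_nonneg_of_pos (qf_nonneg hY _) (nsq_pos hx)
  obtain ⟨c, hc, hc1, hle⟩ := exists_qf_le_contraction (qf_nonneg hY) (N := Fᴴ * Y * F)
    fun x hx => by
      rw [hq x]
      exact lt_add_of_pos_right _ (nsq_pos hx)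
  exact ⟨Y, hYd, c, hc, hc1, fun x => by rw [← qf_conj]; exact hle x⟩

/-- A Gramian-type solution of a Lyapunov equation is positive definite when no eigenvector of `F`
with nonzero eigenvalue is annihilated by `G`: its kernel is invariant under `F` and is
annihilated by `G`, so it would contain such an eigenvector. -/
theorem posDef_of_lyapunov_of_observable {q n : ℕ} {Y F : Matrix (Fin n) (Fin n) ℂ}
    {G : Matrix (Fin q) (Fin n) ℂ} (hY : Y.PosSemidef) (h : Y = Fᴴ * Y * F + Gᴴ * G)
    (hobs : ∀ (μ : ℂ) x, x ≠ 0 → F *ᵥ x = μ • x → G *ᵥ x ≠ 0) : Y.PosDef := by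
  have hq : ∀ x, qf Y x = qf Y (F *ᵥ x) + nsq (G *ᵥ x) := fun x => by
    conv_lhs => rw [h]
    rw [qf_add, qf_conj, qf_gram]
  have hker : ∀ x, Y *ᵥ x = 0 ↔ qf Y x = 0 := fun x => by
    rw [← hY.dotProduct_mulVec_zero_iff, ← coe_qf hY.isHermitian]
    exact Complex.ofReal_eq_zero
  have hstep : ∀ x, Y *ᵥ x = 0 → Y *ᵥ (F *ᵥ x) = 0 ∧ G *ᵥ x = 0 := fun x hx => by
    have h0 := (hker x).1 hx
    rw [hq] at h0
    have h1 := qf_nonneg hY (F *ᵥ x)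
    have h2 := nsq_nonneg (G *ᵥ x)
    exact ⟨(hker _).2 (by linarith), eq_zero_of_nsq_eq_zero (by linarith)⟩
  refine posDef_of_qf_pos hY.isHermitian fun x hx => ?_
  refine lt_of_le_of_ne (qf_nonneg hY x) fun h0 => ?_
  let Z : Submodule ℂ (Fin n → ℂ) := LinearMap.ker Y.mulVecLin
  have hZ : ∀ y ∈ Z, F.mulVecLin y ∈ Z := fun y hy => by
    simpa [Z] using (hstep y (by simpa [Z] using hy)).1
  have hxZ : x ∈ Z := by simpa [Z] using (hker x).2 h0.symm
  have : Nontrivial Z := ⟨⟨x, hxZ⟩, 0, fun h => hx (congrArg Subtype.val h)⟩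
  obtain ⟨μ, hμ⟩ := Module.End.exists_eigenvalue (F.mulVecLin.restrict hZ)
  obtain ⟨y, hy⟩ := hμ.exists_hasEigenvector
  refine hobs μ y (fun h => hy.2 (Subtype.ext h)) ?_ (hstep y (LinearMap.mem_ker.1 y.2)).2
  have := congrArg Subtype.val hy.apply_eq_smul
  simpa using this

theorem exists_lt_one_le_pow {c : ℝ} (hc : c < 1) (n : ℕ) :
    ∃ β : ℝ, 0 < β ∧ β < 1 ∧ c ≤ β ^ n := by
  have h1 : Filter.Tendsto (fun β : ℝ => β ^ n) (nhdsWithin 1 (Set.Iio 1)) (nhds 1) := by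
    have := ((continuous_pow n).tendsto (1 : ℝ)).mono_left
      (nhdsWithin_le_nhds (s := Set.Iio (1 : ℝ)))
    simpa using this
  have h2 : ∀ᶠ β : ℝ in nhdsWithin 1 (Set.Iio 1), 0 < β :=
    nhdsWithin_le_nhds (lt_mem_nhds one_pos)
  obtain ⟨β, ⟨h3, h4⟩, h5⟩ :=
    ((h1.eventually (lt_mem_nhds hc)).and h2 |>.and self_mem_nhdsWithin).exists
  exact ⟨β, h4, h5, h3.le⟩

/-- For an observable pair whose eigenvalues all lie outside the open unit disk, the solution of
`Aᴴ Y A = β (Y + Cᴴ C)` satisfies `|det A|² det Y = βⁿ det (Y + Cᴴ C)`, which bounds `Y + Cᴴ C` by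
a multiple of `Y` in terms of `|det A|`. -/
theorem exists_form_of_antistable {q n : ℕ} {A : Matrix (Fin n) (Fin n) ℂ}
    {C : Matrix (Fin q) (Fin n) ℂ} (hA : ∀ μ ∈ spectrum ℂ A, 1 ≤ ‖μ‖)
    (hobs : ∀ (μ : ℂ) x, x ≠ 0 → A *ᵥ x = μ • x → C *ᵥ x ≠ 0)
    {ρ : ℝ} (hρ : 0 < ρ) (hdet : ρ * ‖A.det‖ ^ 2 < 1) :
    ∃ Y : Matrix (Fin n) (Fin n) ℂ, Y.PosDef ∧ ∃ β : ℝ, 0 < β ∧ β < 1 ∧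
      (∀ x, qf Y (A *ᵥ x) = β * (qf Y x + nsq (C *ᵥ x))) ∧
      ∀ x, ρ * (qf Y x + nsq (C *ᵥ x)) ≤ qf Y x := by
  obtain ⟨β, hβ0, hβ1, hβ⟩ := exists_lt_one_le_pow hdet n
  have hdA : A.det ≠ 0 := fun h => by
    obtain ⟨x, hx, hx0⟩ := Matrix.exists_mulVec_eq_zero_iff.2 h
    have := hA 0 (mem_spectrum_iff_exists_eigenvector.2 ⟨x, hx, by rw [hx0, zero_smul]⟩)
    rw [norm_zero] at this
    linarith
  have hu : IsUnit A.det := isUnit_iff_ne_zero.2 hdA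
  set s : ℂ := ((√β : ℝ) : ℂ) with hs
  have hs0 : s ≠ 0 := by
    rw [hs]
    exact_mod_cast (Real.sqrt_pos.2 hβ0).ne'
  have hss : star s * s = ((β : ℝ) : ℂ) := by
    rw [hs, Complex.star_def, Complex.conj_ofReal, ← Complex.ofReal_mul,
      Real.mul_self_sqrt hβ0.le]
  have hsn : ‖s‖ < 1 := by
    rw [hs, Complex.norm_real, Real.norm_of_nonneg (Real.sqrt_nonneg _)]
    exact (Real.sqrt_lt_sqrt hβ0.le hβ1).trans_eq Real.sqrt_one
  set F := s • A⁻¹ with hF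
  -- eigenvectors of `F` are eigenvectors of `A`
  have heig : ∀ (μ : ℂ) x, x ≠ 0 → F *ᵥ x = μ • x → μ ≠ 0 ∧ A *ᵥ x = (s / μ) • x := by
    intro μ x hx h
    have h1 : s • x = μ • (A *ᵥ x) := by
      have := congrArg (A *ᵥ ·) h
      simpa [hF, Matrix.smul_mulVec, Matrix.mulVec_smul, Matrix.mul_nonsing_inv _ hu] using this
    have hμ : μ ≠ 0 := by
      rintro rfl
      rw [zero_smul] at h1
      exact (smul_ne_zero hs0 hx) h1
    exact ⟨hμ, by rw [div_eq_inv_mul, mul_smul, h1, smul_smul, inv_mul_cancel₀ hμ, one_smul]⟩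
  have hFs : SchurStable F := by
    intro μ hμ
    obtain ⟨x, hx, h⟩ := mem_spectrum_iff_exists_eigenvector.1 hμ
    obtain ⟨hμ0, h1⟩ := heig μ x hx h
    have h2 := hA _ (mem_spectrum_iff_exists_eigenvector.2 ⟨x, hx, h1⟩)
    rw [norm_div, le_div_iff₀ (norm_pos_iff.2 hμ0), one_mul] at h2
    exact h2.trans_lt hsn
  obtain ⟨Y, hY, hYe⟩ := hFs.exists_lyapunov (Matrix.posSemidef_conjTranspose_mul_self (C * F))
  have hYd : Y.PosDef := posDef_of_lyapunov_of_observable hY hYe fun μ x hx h h0 => by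
    obtain ⟨hμ, h1⟩ := heig μ x hx h
    refine hobs _ x hx h1 ?_
    rw [← Matrix.mulVec_mulVec, h, Matrix.mulVec_smul] at h0
    exact (smul_eq_zero.1 h0).resolve_left hμ
  have hFA : F * A = s • (1 : Matrix (Fin n) (Fin n) ℂ) := by
    rw [hF, Matrix.smul_mul, Matrix.nonsing_inv_mul _ hu]
  have hAYA : Aᴴ * Y * A = ((β : ℝ) : ℂ) • (Y + Cᴴ * C) := by
    have h1 : Aᴴ * Y * A = (F * A)ᴴ * (Y + Cᴴ * C) * (F * A) := by
      conv_lhs => rw [hYe]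
      simp only [Matrix.conjTranspose_mul, Matrix.mul_add, Matrix.add_mul, Matrix.mul_assoc]
    rw [h1, hFA, Matrix.conjTranspose_smul, Matrix.conjTranspose_one, Matrix.smul_mul,
      Matrix.one_mul, Matrix.mul_smul, Matrix.mul_one, smul_smul, mul_comm, hss]
  have hH : ∀ x, qf (Y + Cᴴ * C) x = qf Y x + nsq (C *ᵥ x) := fun x => by rw [qf_add, qf_gram]
  refine ⟨Y, hYd, β, hβ0, hβ1, fun x => ?_, fun x => ?_⟩
  · rw [← qf_conj, hAYA, ← hH, ← qf_smul]
    rfl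
  · rw [← hH]
    refine mul_qf_le_of_mul_det_le hYd ?_ hρ ?_ x
    · rw [add_sub_cancel_left]
      exact Matrix.posSemidef_conjTranspose_mul_self C
    · have h1 := congrArg (fun M => ‖Matrix.det M‖) hAYA
      simp only [Matrix.det_mul, Matrix.det_smul, Matrix.det_conjTranspose, norm_mul, norm_star,
        norm_pow, Complex.norm_real, Real.norm_of_nonneg hβ0.le, Fintype.card_fin] at h1
      have h2 : 0 < β ^ n := by positivity
      refine le_of_mul_le_mul_left (a := β ^ n) ?_ h2
      calc β ^ n * (ρ * ‖(Y + Cᴴ * C).det‖) = ρ * ‖A.det‖ ^ 2 * ‖Y.det‖ := by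
            linear_combination (-ρ) * h1
        _ ≤ β ^ n * ‖Y.det‖ := by gcongr

/-- The form for a detectable pair: the antistable and the stable blocks are combined with a large
weight `w` on the stable block, which absorbs the effect of that block on the output. -/
theorem exists_form_of_detectable {q n : ℕ} {A : Matrix (Fin n) (Fin n) ℝ}
    {C : Matrix (Fin q) (Fin n) ℂ}
    (hobs : ∀ (μ : ℂ) x, x ≠ 0 → 1 ≤ ‖μ‖ → cplx A *ᵥ x = μ • x → C *ᵥ x ≠ 0)
    {ρ : ℝ} (hρ : 0 < ρ) (hdet : ρ * unstableProduct A ^ 2 < 1) :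
    ∃ Y : Matrix (Fin n) (Fin n) ℂ, Y.PosDef ∧ ∃ β : ℝ, 0 < β ∧ β < 1 ∧
      (∀ x, qf Y (cplx A *ᵥ x) ≤ β * (qf Y x + nsq (C *ᵥ x))) ∧
      ∀ x, ρ * (qf Y x + nsq (C *ᵥ x)) ≤ qf Y x := by
  obtain ⟨a, b, As, Au, Ts, Tu, Rs, Ru, hTs, hTu, hRu, hid, hTR, hs, hu, hchar⟩ :=
    exists_spectral_splitting (cplx A)
  rw [← norm_det_eq_unstableProduct hs hu hchar] at hdet
  obtain ⟨Ys, hYs, c, hc0, hc1, hYsc⟩ := hs.exists_contracting_form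
  -- `ρ` is enlarged to `(1 + ε) ρ` to leave room for the Young inequality
  obtain ⟨ε₁, hε₁0, hε₁⟩ : ∃ ε : ℝ, 0 < ε ∧ (1 + ε) * ρ * ‖Au.det‖ ^ 2 < 1 := by
    have h1 : Filter.Tendsto (fun ε : ℝ => (1 + ε) * ρ * ‖Au.det‖ ^ 2)
        (nhdsWithin 0 (Set.Ioi 0)) (nhds ((1 + 0) * ρ * ‖Au.det‖ ^ 2)) :=
      ((by fun_prop : Continuous fun ε : ℝ => (1 + ε) * ρ * ‖Au.det‖ ^ 2).tendsto 0).mono_left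
        nhdsWithin_le_nhds
    rw [add_zero, one_mul] at h1
    obtain ⟨ε, h2, h3⟩ := ((h1.eventually (gt_mem_nhds hdet)).and self_mem_nhdsWithin).exists
    exact ⟨ε, h3, h2⟩
  have hobsu : ∀ (μ : ℂ) x, x ≠ 0 → Au *ᵥ x = μ • x → (C * Ru) *ᵥ x ≠ 0 := fun μ x hx h => by
    rw [← Matrix.mulVec_mulVec]
    refine hobs μ (Ru *ᵥ x) (fun h0 => hx ?_)
      (hu μ (mem_spectrum_iff_exists_eigenvector.2 ⟨x, hx, h⟩)) ?_
    · have := congrArg (Tu *ᵥ ·) h0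
      simpa [hTR] using this
    · rw [Matrix.mulVec_mulVec, hRu, ← Matrix.mulVec_mulVec, h, Matrix.mulVec_smul]
  obtain ⟨Yu, hYu, β₀, hβ₀, hβ₀1, hYu1, hYu2⟩ :=
    exists_form_of_antistable hu hobsu (by positivity) hε₁
  obtain ⟨ε, hε, hεε, hεβ⟩ : ∃ ε : ℝ, 0 < ε ∧ ε ≤ ε₁ ∧ (1 + ε) * β₀ < 1 := by
    refine ⟨min ε₁ ((1 - β₀) / 2), lt_min hε₁0 (by linarith), min_le_left _ _, ?_⟩
    have : min ε₁ ((1 - β₀) / 2) ≤ (1 - β₀) / 2 := min_le_right _ _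
    nlinarith
  obtain ⟨κ, hκ, hκle⟩ := exists_qf_le_mul (fun x hx => qf_pos hYs hx) ((C * Rs)ᴴ * (C * Rs))
  -- coordinates of a vector in the two blocks
  have hC : ∀ x, C *ᵥ x = (C * Rs) *ᵥ (Ts *ᵥ x) + (C * Ru) *ᵥ (Tu *ᵥ x) := fun x => by
    have : C = C * Rs * Ts + C * Ru * Tu := by
      rw [Matrix.mul_assoc, Matrix.mul_assoc, ← Matrix.mul_add, hid, Matrix.mul_one]
    conv_lhs => rw [this]
    rw [Matrix.add_mulVec, Matrix.mulVec_mulVec, Matrix.mulVec_mulVec]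
  have hAs : ∀ x, Ts *ᵥ (cplx A *ᵥ x) = As *ᵥ (Ts *ᵥ x) := fun x => by
    rw [Matrix.mulVec_mulVec, Matrix.mulVec_mulVec, hTs]
  have hAu : ∀ x, Tu *ᵥ (cplx A *ᵥ x) = Au *ᵥ (Tu *ᵥ x) := fun x => by
    rw [Matrix.mulVec_mulVec, Matrix.mulVec_mulVec, hTu]
  set K := (1 + 1 / ε) * κ with hK
  have hK0 : 0 < K := by positivity
  have hstab : ∀ z, (1 + 1 / ε) * nsq ((C * Rs) *ᵥ z) ≤ K * qf Ys z := fun z => by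
    have := hκle z
    rw [qf_gram] at this
    rw [hK, mul_assoc]
    gcongr
  have young₁ : ∀ x, nsq (C *ᵥ x) ≤
      (1 + ε) * nsq ((C * Ru) *ᵥ (Tu *ᵥ x)) + K * qf Ys (Ts *ᵥ x) := fun x => by
    rw [hC, add_comm]
    exact (nsq_add_le hε _ _).trans (add_le_add le_rfl (hstab _))
  have young₂ : ∀ x, nsq ((C * Ru) *ᵥ (Tu *ᵥ x)) ≤
      (1 + ε) * nsq (C *ᵥ x) + K * qf Ys (Ts *ᵥ x) := fun x => by
    have h1 : (C * Ru) *ᵥ (Tu *ᵥ x) = C *ᵥ x + -((C * Rs) *ᵥ (Ts *ᵥ x)) := by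
      rw [hC]
      abel
    rw [h1]
    refine (nsq_add_le hε _ _).trans ?_
    rw [nsq_neg]
    exact add_le_add le_rfl (hstab _)
  obtain ⟨β, hβ1, hββ₀, hβc⟩ : ∃ β : ℝ, β < 1 ∧ (1 + ε) * β₀ ≤ β ∧ c < β :=
    ⟨max ((1 + ε) * β₀) ((1 + c) / 2), max_lt hεβ (by linarith), le_max_left _ _,
      lt_of_lt_of_le (by linarith) (le_max_right _ _)⟩
  have hβ0 : 0 < β := hc0.trans hβc
  have hβ₀β : β₀ ≤ β := by nlinarith
  have hρ1 : ρ < 1 := by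
    have h1 : 1 ≤ ‖Au.det‖ := by
      have : ∀ t : Multiset ℂ, (∀ μ ∈ t, 1 ≤ ‖μ‖) → 1 ≤ ‖t.prod‖ := fun t => by
        induction t using Multiset.induction_on with
        | empty => simp
        | cons μ t ih =>
          intro h
          rw [Multiset.prod_cons, norm_mul]
          exact one_le_mul_of_one_le_of_one_le (h μ (Multiset.mem_cons_self _ _))
            (ih fun ν hν => h ν (Multiset.mem_cons_of_mem hν))
      rw [Matrix.det_eq_prod_roots_charpoly]
      exact this _ fun μ hμ =>
        hu μ (Matrix.mem_spectrum_iff_isRoot_charpoly.2 (Polynomial.isRoot_of_mem_roots hμ))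
    nlinarith
  obtain ⟨w, hw, hw1, hw2⟩ : ∃ w : ℝ, 0 < w ∧ β₀ * K + c * w ≤ β * w ∧ ρ * (w + K) ≤ w := by
    refine ⟨max (β₀ * K / (β - c)) (ρ * K / (1 - ρ)), ?_, ?_, ?_⟩
    · exact lt_max_of_lt_left (div_pos (by positivity) (by linarith))
    · have := (div_le_iff₀ (by linarith : 0 < β - c)).1
        (le_max_left (β₀ * K / (β - c)) (ρ * K / (1 - ρ)))
      linarith
    · have := (div_le_iff₀ (by linarith : 0 < 1 - ρ)).1
        (le_max_right (β₀ * K / (β - c)) (ρ * K / (1 - ρ)))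
      linarith
  have hq : ∀ x, qf (Tuᴴ * Yu * Tu + w • (Tsᴴ * Ys * Ts)) x =
      qf Yu (Tu *ᵥ x) + w * qf Ys (Ts *ᵥ x) := fun x => by
    rw [qf_add, qf_smul, qf_conj, qf_conj]
  have hu0 := fun x => qf_nonneg hYu.posSemidef (Tu *ᵥ x)
  have hs0 := fun x => qf_nonneg hYs.posSemidef (Ts *ᵥ x)
  refine ⟨Tuᴴ * Yu * Tu + w • (Tsᴴ * Ys * Ts), posDef_of_qf_pos ?_ fun x hx => ?_,
    β, hβ0, hβ1, fun x => ?_, fun x => ?_⟩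
  · exact (hYu.posSemidef.conjTranspose_mul_mul_same Tu).isHermitian.add
      ((hYs.posSemidef.conjTranspose_mul_mul_same Ts).isHermitian.smul (IsSelfAdjoint.all w))
  · rw [hq]
    by_cases h1 : Tu *ᵥ x = 0
    · have h2 : Ts *ᵥ x ≠ 0 := fun h2 => hx <| by
        have h3 : x = Rs *ᵥ (Ts *ᵥ x) + Ru *ᵥ (Tu *ᵥ x) := by
          rw [Matrix.mulVec_mulVec, Matrix.mulVec_mulVec, ← Matrix.add_mulVec, hid,
            Matrix.one_mulVec]
        rw [h3, h1, h2, Matrix.mulVec_zero, Matrix.mulVec_zero, add_zero]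
      exact add_pos_of_nonneg_of_pos (hu0 x) (mul_pos hw (qf_pos hYs h2))
    · exact add_pos_of_pos_of_nonneg (qf_pos hYu h1) (mul_nonneg hw.le (hs0 x))
  · rw [hq, hq, hAs, hAu, hYu1]
    have h1 := hYsc (Ts *ᵥ x)
    have h2 := young₂ x
    calc _ ≤ β₀ * (qf Yu (Tu *ᵥ x) + ((1 + ε) * nsq (C *ᵥ x) + K * qf Ys (Ts *ᵥ x))) +
            w * (c * qf Ys (Ts *ᵥ x)) := by gcongr
      _ = β₀ * qf Yu (Tu *ᵥ x) + (1 + ε) * β₀ * nsq (C *ᵥ x) +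
            (β₀ * K + c * w) * qf Ys (Ts *ᵥ x) := by ring
      _ ≤ β * qf Yu (Tu *ᵥ x) + β * nsq (C *ᵥ x) + β * w * qf Ys (Ts *ᵥ x) := by
        gcongr
        · exact hu0 x
        · exact nsq_nonneg _
        · exact hs0 x
      _ = _ := by ring
  · rw [hq]
    have h1 := hYu2 (Tu *ᵥ x)
    have h2 := young₁ x
    have h3 : 0 ≤ nsq ((C * Ru) *ᵥ (Tu *ᵥ x)) := nsq_nonneg _
    calc _ ≤ ρ * (qf Yu (Tu *ᵥ x) + w * qf Ys (Ts *ᵥ x) +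
            ((1 + ε) * nsq ((C * Ru) *ᵥ (Tu *ᵥ x)) + K * qf Ys (Ts *ᵥ x))) := by gcongr
      _ = ρ * qf Yu (Tu *ᵥ x) + (1 + ε) * ρ * nsq ((C * Ru) *ᵥ (Tu *ᵥ x)) +
            ρ * (w + K) * qf Ys (Ts *ᵥ x) := by ring
      _ ≤ (1 + ε₁) * ρ * qf Yu (Tu *ᵥ x) + (1 + ε₁) * ρ * nsq ((C * Ru) *ᵥ (Tu *ᵥ x)) +
            w * qf Ys (Ts *ᵥ x) := by
        gcongr
        · exact hu0 x
        · nlinarith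
        · exact hs0 x
      _ ≤ _ := by linarith

end LyapunovForms

/-! ### Symmetric real matrices -/

section RealForms

theorem isSymm_of_posSemidef {n : Type*} {M : Matrix n n ℝ} (hM : M.PosSemidef) : M.IsSymm := by
  have := hM.isHermitian.eq
  rwa [Matrix.conjTranspose_eq_transpose_of_trivial] at this

variable {n : Type*} [Fintype n]

theorem qf_real (M : Matrix n n ℝ) (x : n → ℝ) : qf M x = x ⬝ᵥ (M *ᵥ x) := by
  simp [qf]

theorem nsq_real (x : n → ℝ) : nsq x = x ⬝ᵥ x := by
  simp [nsq]

theorem dotProduct_mulVec_comm_of_isSymm {M : Matrix n n ℝ} (hM : M.IsSymm) (x y : n → ℝ) :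
    x ⬝ᵥ (M *ᵥ y) = y ⬝ᵥ (M *ᵥ x) := by
  rw [Matrix.dotProduct_mulVec, dotProduct_comm, ← Matrix.mulVec_transpose, hM.eq]

theorem qf_sub_smul {M : Matrix n n ℝ} (hM : M.IsSymm) (x y : n → ℝ) (t : ℝ) :
    qf M (x - t • y) = qf M x - 2 * t * (x ⬝ᵥ (M *ᵥ y)) + t ^ 2 * qf M y := by
  simp only [qf_real, Matrix.mulVec_sub, Matrix.mulVec_smul, dotProduct_sub, sub_dotProduct,
    dotProduct_smul, smul_dotProduct, smul_eq_mul, dotProduct_mulVec_comm_of_isSymm hM y x]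
  ring

/-- Polarization: a symmetric matrix is determined by its form. -/
theorem apply_eq_of_isSymm [DecidableEq n] {M : Matrix n n ℝ} (hM : M.IsSymm) (i j : n) :
    M i j = (qf M (Pi.single i 1 + Pi.single j 1) - qf M (Pi.single i 1) -
      qf M (Pi.single j 1)) / 2 := by
  have h1 : ∀ k l : n, (Pi.single k (1 : ℝ)) ⬝ᵥ (M *ᵥ Pi.single l 1) = M k l := fun k l => by
    simp
  simp only [qf_real, Matrix.mulVec_add, dotProduct_add, add_dotProduct, h1, hM.apply i j]
  ring

theorem qf_conj_transpose {m : Type*} [Fintype m] (T : Matrix n m ℝ) (M : Matrix m m ℝ)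
    (x : n → ℝ) : qf (T * M * Tᵀ) x = qf M (Tᵀ *ᵥ x) := by
  rw [← qf_conj, Matrix.conjTranspose_eq_transpose_of_trivial, Matrix.transpose_transpose]

theorem qf_mul_transpose_self {m : Type*} [Fintype m] (T : Matrix n m ℝ) (x : n → ℝ) :
    qf (T * Tᵀ) x = nsq (Tᵀ *ᵥ x) := by
  rw [← qf_gram, Matrix.conjTranspose_eq_transpose_of_trivial, Matrix.transpose_transpose]

theorem trace_mul_nonneg {N P : Matrix n n ℝ} (hN : N.PosSemidef) (hP : P.PosSemidef) :
    0 ≤ (N * P).trace := by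
  classical
  open scoped MatrixOrder in
  obtain ⟨S, hS, hSh⟩ : ∃ S : Matrix n n ℝ, S * S = P ∧ Sᴴ = S :=
    ⟨CFC.sqrt P, CFC.sqrt_mul_sqrt_self P (Matrix.nonneg_iff_posSemidef.2 hP),
      (Matrix.nonneg_iff_posSemidef.1 (CFC.sqrt_nonneg P)).isHermitian.eq⟩
  have h := (hN.conjTranspose_mul_mul_same S).trace_nonneg
  rwa [hSh, Matrix.trace_mul_comm, ← Matrix.mul_assoc, hS, Matrix.trace_mul_comm] at h

theorem trace_mul_le_of_qf_le {N M P : Matrix n n ℝ} (hN : N.IsSymm) (hM : M.IsSymm)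
    (h : ∀ x, qf N x ≤ qf M x) (hP : P.PosSemidef) : (N * P).trace ≤ (M * P).trace := by
  have h1 : (M - N).PosSemidef := posSemidef_of_qf_nonneg
    (by
      rw [Matrix.IsHermitian, Matrix.conjTranspose_eq_transpose_of_trivial, Matrix.transpose_sub,
        hN.eq, hM.eq])
    fun x => by rw [qf_sub]; exact sub_nonneg.2 (h x)
  have := trace_mul_nonneg h1 hP
  rwa [Matrix.sub_mul, Matrix.trace_sub, sub_nonneg] at this

/-- A sequence of symmetric matrices whose forms increase and are bounded pointwise converges. -/
theorem exists_tendsto_of_qf_mono {n : ℕ} {P : ℕ → Matrix (Fin n) (Fin n) ℝ}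
    (hP : ∀ k, (P k).IsSymm)
    (hmono : ∀ k x, qf (P k) x ≤ qf (P (k + 1)) x) (hbdd : ∀ x, ∃ c, ∀ k, qf (P k) x ≤ c) :
    ∃ X, Filter.Tendsto P Filter.atTop (nhds X) := by
  have hlim : ∀ x, ∃ l, Filter.Tendsto (fun k => qf (P k) x) Filter.atTop (nhds l) := fun x => by
    obtain ⟨c, hc⟩ := hbdd x
    exact ⟨_, tendsto_atTop_ciSup (monotone_nat_of_le_succ fun k => hmono k x)
      ⟨c, by rintro _ ⟨k, rfl⟩; exact hc k⟩⟩
  choose l hl using hlim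
  refine ⟨fun i j => (l (Pi.single i 1 + Pi.single j 1) - l (Pi.single i 1) -
    l (Pi.single j 1)) / 2, ?_⟩
  refine tendsto_pi_nhds.2 fun i => tendsto_pi_nhds.2 fun j => ?_
  simp only [fun k => apply_eq_of_isSymm (hP k) i j]
  exact (((hl _).sub (hl _)).sub (hl _)).div_const 2

end RealForms

/-! ### Complexification -/

section Complexification

variable {m n : ℕ}

/-- The complex vector with the same entries as a real vector. -/
def cvec (x : Fin n → ℝ) : Fin n → ℂ := fun i => (x i : ℂ)

theorem cplx_mulVec_cvec (M : Matrix (Fin m) (Fin n) ℝ) (x : Fin n → ℝ) :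
    cplx M *ᵥ cvec x = cvec (M *ᵥ x) := by
  ext i
  simp [cplx, cvec, Matrix.mulVec, dotProduct]

theorem cplx_mul {l : ℕ} (M : Matrix (Fin m) (Fin n) ℝ) (N : Matrix (Fin n) (Fin l) ℝ) :
    cplx (M * N) = cplx M * cplx N := Matrix.map_mul (f := Complex.ofRealHom)

theorem cplx_add (M N : Matrix (Fin m) (Fin n) ℝ) : cplx (M + N) = cplx M + cplx N :=
  Matrix.map_add _ Complex.ofReal_add M N

theorem cplx_transpose (M : Matrix (Fin m) (Fin n) ℝ) : cplx Mᵀ = (cplx M)ᴴ := by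
  ext i j
  simp [cplx]

theorem nsq_cvec (x : Fin n → ℝ) : nsq (cvec x) = nsq x := by
  simp [nsq_eq_sum, cvec]

theorem qf_cvec (M : Matrix (Fin n) (Fin n) ℂ) (x : Fin n → ℝ) :
    qf M (cvec x) = qf (M.map Complex.re) x := by
  simp [qf, cvec, dotProduct, Matrix.mulVec, Finset.mul_sum]

theorem qf_cplx (M : Matrix (Fin n) (Fin n) ℝ) (z : Fin n → ℂ) :
    qf (cplx M) z = qf M (fun i => (z i).re) + qf M (fun i => (z i).im) := by
  simp only [qf, cplx, dotProduct, Matrix.mulVec, Finset.mul_sum, map_sum, Pi.star_apply,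
    ← Finset.sum_add_distrib]
  refine Finset.sum_congr rfl fun i _ => Finset.sum_congr rfl fun j _ => ?_
  simp

end Complexification

/-! ### Mean-square detectability -/

section MeanSquare

open scoped ComplexOrder

/-- For a detectable pair with `ρ` below the critical value there are a gain `L` and a form `Y`
which contracts on average when the output injection is lost with probability `ρ`. -/
theorem exists_meanSquare_contraction {n q : ℕ} {A : Matrix (Fin n) (Fin n) ℝ}
    {C : Matrix (Fin q) (Fin n) ℝ} (hdet : Detectable A C) {ρ : ℝ} (hρ : 0 < ρ) (hρ1 : ρ < 1)
    (hρA : ρ * unstableProduct A ^ 2 < 1) :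
    ∃ (L : Matrix (Fin n) (Fin q) ℝ) (Y : Matrix (Fin n) (Fin n) ℝ), Y.PosDef ∧
      ∃ β : ℝ, 0 < β ∧ β < 1 ∧ ∀ x,
        ρ * qf Y (A *ᵥ x) + (1 - ρ) * qf Y ((A + L * C) *ᵥ x) ≤ β * qf Y x := by
  have hobs : ∀ (μ : ℂ) x, x ≠ 0 → 1 ≤ ‖μ‖ → cplx A *ᵥ x = μ • x → cplx C *ᵥ x ≠ 0 := by
    intro μ x hx hμ h h0
    obtain ⟨F, hF⟩ := hdet
    refine (hF μ (mem_spectrum_iff_exists_eigenvector.2 ⟨x, hx, ?_⟩)).not_ge hμ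
    rw [cplx_add, cplx_mul, Matrix.add_mulVec, h, ← Matrix.mulVec_mulVec, h0, Matrix.mulVec_zero,
      add_zero]
  obtain ⟨Yc, hYc, β, hβ0, hβ1, h₁, h₂⟩ := exists_form_of_detectable hobs hρ hρA
  set Y := Yc.map Complex.re with hYdef
  have hY : Y.PosDef := by
    refine posDef_of_qf_pos ?_ fun x hx => ?_
    · ext i j
      have := congrArg Complex.re (hYc.isHermitian.apply i j)
      simpa [hYdef] using this
    · rw [hYdef, ← qf_cvec]
      refine qf_pos hYc fun h => hx ?_
      ext i
      have := congrFun h i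
      simpa [cvec] using this
  have h₁' : ∀ x, qf Y (A *ᵥ x) ≤ β * (qf Y x + nsq (C *ᵥ x)) := fun x => by
    have := h₁ (cvec x)
    rwa [cplx_mulVec_cvec, cplx_mulVec_cvec, qf_cvec, qf_cvec, nsq_cvec] at this
  have h₂' : ∀ x, ρ * (qf Y x + nsq (C *ᵥ x)) ≤ qf Y x := fun x => by
    have := h₂ (cvec x)
    rwa [cplx_mulVec_cvec, qf_cvec, nsq_cvec] at this
  set H := Y + Cᵀ * C with hH
  have hgram : ∀ x, qf (Cᵀ * C) x = nsq (C *ᵥ x) := fun x => by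
    rw [← qf_gram, Matrix.conjTranspose_eq_transpose_of_trivial]
  have hHq : ∀ x, qf H x = qf Y x + nsq (C *ᵥ x) := fun x => by rw [hH, qf_add, hgram]
  have hCC : (Cᵀ * C).PosSemidef := by
    rw [← Matrix.conjTranspose_eq_transpose_of_trivial]
    exact Matrix.posSemidef_conjTranspose_mul_self C
  have hHd : H.PosDef := hY.add_posSemidef hCC
  have hHs := isSymm_of_posSemidef hHd.posSemidef
  have hHu : IsUnit H.det := (Matrix.isUnit_iff_isUnit_det _).1 hHd.isUnit
  have hl : 0 < 1 - ρ := by linarith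
  refine ⟨-((1 - ρ)⁻¹ • (A * H⁻¹ * Cᵀ)), Y, hY, β, hβ0, hβ1, fun x => ?_⟩
  set g := H⁻¹ *ᵥ (Cᵀ *ᵥ (C *ᵥ x)) with hg
  have hL : (A + -((1 - ρ)⁻¹ • (A * H⁻¹ * Cᵀ)) * C) *ᵥ x = A *ᵥ (x - (1 - ρ)⁻¹ • g) := by
    rw [hg, Matrix.add_mulVec, Matrix.neg_mul, Matrix.neg_mulVec, Matrix.smul_mul,
      Matrix.smul_mulVec, Matrix.mulVec_sub, Matrix.mulVec_smul, ← sub_eq_add_neg]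
    simp only [Matrix.mulVec_mulVec, Matrix.mul_assoc]
  have hHg : H *ᵥ g = Cᵀ *ᵥ (C *ᵥ x) := by
    rw [hg, Matrix.mulVec_mulVec, Matrix.mul_nonsing_inv _ hHu, Matrix.one_mulVec]
  have hadj : ∀ y, y ⬝ᵥ (H *ᵥ g) = (C *ᵥ y) ⬝ᵥ (C *ᵥ x) := fun y => by
    rw [hHg, Matrix.dotProduct_mulVec, Matrix.vecMul_transpose]
  have e1 := qf_sub_smul hHs x g (1 - ρ)⁻¹
  rw [hadj x, ← nsq_real] at e1
  have e2 : qf H g = (C *ᵥ g) ⬝ᵥ (C *ᵥ x) := by rw [qf_real, hadj]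
  have e3 := h₂' g
  rw [← hHq] at e3
  -- `qf H g ≤ (1 - ρ) nsq (C x)`, from the square of `C g - (1 - ρ) C x`
  have e4 : nsq (C *ᵥ g - (1 - ρ) • (C *ᵥ x)) =
      nsq (C *ᵥ g) - 2 * (1 - ρ) * qf H g + (1 - ρ) ^ 2 * nsq (C *ᵥ x) := by
    rw [← qf_one, qf_sub_smul Matrix.isSymm_one, Matrix.one_mulVec, ← e2, qf_one, qf_one]
  have e5 := nsq_nonneg (C *ᵥ g - (1 - ρ) • (C *ᵥ x))
  have e6 : qf H g ≤ (1 - ρ) * nsq (C *ᵥ x) := by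
    have h3 := hHq g
    have : (1 - ρ) * qf H g ≤ (1 - ρ) * ((1 - ρ) * nsq (C *ᵥ x)) := by nlinarith
    exact le_of_mul_le_mul_left this hl
  rw [hL]
  calc ρ * qf Y (A *ᵥ x) + (1 - ρ) * qf Y (A *ᵥ (x - (1 - ρ)⁻¹ • g))
      ≤ ρ * (β * qf H x) + (1 - ρ) * (β * qf H (x - (1 - ρ)⁻¹ • g)) := by
        rw [hHq, hHq]
        gcongr
        · exact h₁' x
        · exact h₁' _
    _ = β * (qf H x - 2 * nsq (C *ᵥ x) + (1 - ρ)⁻¹ * qf H g) := by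
        rw [e1]
        field_simp
        ring
    _ ≤ β * (qf H x - 2 * nsq (C *ᵥ x) + (1 - ρ)⁻¹ * ((1 - ρ) * nsq (C *ᵥ x))) := by
        gcongr
    _ = β * qf Y x := by
        rw [hHq]
        field_simp
        ring

end MeanSquare

/-! ### The modified algebraic Riccati equation -/

section Riccati

variable {n q : ℕ}

/-- The map whose fixed points are the solutions of the modified algebraic Riccati equation with
`ρ = δ ^ 2`. -/
noncomputable def mareMap (A : Matrix (Fin n) (Fin n) ℝ) (C : Matrix (Fin q) (Fin n) ℝ) (ρ : ℝ)
    (Q P : Matrix (Fin n) (Fin n) ℝ) : Matrix (Fin n) (Fin n) ℝ :=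
  A * P * Aᵀ - (1 - ρ) • (A * P * Cᵀ * (C * P * Cᵀ + 1)⁻¹ * C * P * Aᵀ) + Q

/-- Propagation of the error covariance `P` when the gain `L` is applied with probability `1 - ρ`.
For each `P` the Riccati map is its minimum over `L`. -/
noncomputable def gainMap (A : Matrix (Fin n) (Fin n) ℝ) (C : Matrix (Fin q) (Fin n) ℝ) (ρ : ℝ)
    (Q : Matrix (Fin n) (Fin n) ℝ) (L : Matrix (Fin n) (Fin q) ℝ) (P : Matrix (Fin n) (Fin n) ℝ) :
    Matrix (Fin n) (Fin n) ℝ :=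
  ρ • (A * P * Aᵀ) + (1 - ρ) • ((A + L * C) * P * (A + L * C)ᵀ + L * Lᵀ) + Q

variable {A : Matrix (Fin n) (Fin n) ℝ} {C : Matrix (Fin q) (Fin n) ℝ} {ρ : ℝ}
  {Q P : Matrix (Fin n) (Fin n) ℝ}

theorem posDef_innovation (hP : P.PosSemidef) : (C * P * Cᵀ + 1).PosDef := by
  have h := hP.mul_mul_conjTranspose_same C
  rw [Matrix.conjTranspose_eq_transpose_of_trivial] at h
  exact Matrix.PosDef.one.posSemidef_add h

theorem isUnit_det_innovation (C : Matrix (Fin q) (Fin n) ℝ) (hP : P.PosSemidef) :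
    IsUnit (C * P * Cᵀ + 1).det :=
  (Matrix.isUnit_iff_isUnit_det _).1 (posDef_innovation hP).isUnit

theorem observerGain_mul_innovation (A : Matrix (Fin n) (Fin n) ℝ) (C : Matrix (Fin q) (Fin n) ℝ)
    (hP : P.PosSemidef) : observerGain A C P * (C * P * Cᵀ + 1) = -(A * P * Cᵀ) := by
  rw [observerGain, Matrix.neg_mul, Matrix.mul_assoc,
    Matrix.nonsing_inv_mul _ (isUnit_det_innovation C hP), Matrix.mul_one]

/-- The correction term of the Riccati map, in terms of the optimal gain. -/
theorem correction_eq (A : Matrix (Fin n) (Fin n) ℝ) (C : Matrix (Fin q) (Fin n) ℝ)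
    (hP : P.PosSemidef) :
    A * P * Cᵀ * (C * P * Cᵀ + 1)⁻¹ * C * P * Aᵀ =
      observerGain A C P * (C * P * Cᵀ + 1) * (observerGain A C P)ᵀ := by
  have hs := isSymm_of_posSemidef hP
  have hW := isSymm_of_posSemidef (posDef_innovation (C := C) hP).posSemidef
  rw [observerGain_mul_innovation A C hP, observerGain, Matrix.transpose_neg, Matrix.neg_mul,
    Matrix.mul_neg, neg_neg, Matrix.transpose_mul, Matrix.transpose_nonsing_inv, hW.eq,
    Matrix.transpose_mul, Matrix.transpose_mul, Matrix.transpose_transpose, hs.eq]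
  simp only [Matrix.mul_assoc]

/-- Completion of the square. -/
theorem gainMap_eq (A : Matrix (Fin n) (Fin n) ℝ) (C : Matrix (Fin q) (Fin n) ℝ) (ρ : ℝ)
    (Q : Matrix (Fin n) (Fin n) ℝ) (L : Matrix (Fin n) (Fin q) ℝ) (hP : P.PosSemidef) :
    gainMap A C ρ Q L P = mareMap A C ρ Q P + (1 - ρ) • ((L - observerGain A C P) *
      (C * P * Cᵀ + 1) * (L - observerGain A C P)ᵀ) := by
  have hs := isSymm_of_posSemidef hP
  have hW := isSymm_of_posSemidef (posDef_innovation (C := C) hP).posSemidef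
  have h1 := observerGain_mul_innovation A C hP
  have h2 : (C * P * Cᵀ + 1) * (observerGain A C P)ᵀ = -(C * P * Aᵀ) := by
    have := congrArg Matrix.transpose h1
    rw [Matrix.transpose_mul, hW.eq, Matrix.transpose_neg, Matrix.transpose_mul,
      Matrix.transpose_mul, Matrix.transpose_transpose, hs.eq, ← Matrix.mul_assoc] at this
    exact this
  rw [gainMap, mareMap, correction_eq A C hP]
  set G := observerGain A C P
  have e1 : (L - G) * (C * P * Cᵀ + 1) * (L - G)ᵀ =
      L * (C * P * Cᵀ) * Lᵀ + L * Lᵀ + L * (C * P * Aᵀ) + A * P * Cᵀ * Lᵀ +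
        G * (C * P * Cᵀ + 1) * Gᵀ := by
    have : (L - G) * (C * P * Cᵀ + 1) * (L - G)ᵀ =
        L * (C * P * Cᵀ + 1) * Lᵀ - L * ((C * P * Cᵀ + 1) * Gᵀ) -
          G * (C * P * Cᵀ + 1) * Lᵀ + G * (C * P * Cᵀ + 1) * Gᵀ := by
      rw [Matrix.transpose_sub, Matrix.sub_mul, Matrix.sub_mul, Matrix.mul_sub, Matrix.mul_sub,
        Matrix.mul_assoc L _ Gᵀ]
      abel
    rw [this, h2, h1, Matrix.mul_add L, Matrix.mul_one, Matrix.add_mul, Matrix.mul_neg,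
      Matrix.neg_mul]
    abel
  have e2 : (A + L * C) * P * (A + L * C)ᵀ =
      A * P * Aᵀ + L * (C * P * Aᵀ) + A * P * Cᵀ * Lᵀ + L * (C * P * Cᵀ) * Lᵀ := by
    rw [Matrix.transpose_add, Matrix.transpose_mul]
    simp only [Matrix.add_mul, Matrix.mul_add, Matrix.mul_assoc]
    abel
  rw [e1, e2]
  module

theorem qf_gainMap (L : Matrix (Fin n) (Fin q) ℝ) (x : Fin n → ℝ) :
    qf (gainMap A C ρ Q L P) x = ρ * qf P (Aᵀ *ᵥ x) +
      (1 - ρ) * (qf P ((A + L * C)ᵀ *ᵥ x) + nsq (Lᵀ *ᵥ x)) + qf Q x := by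
  rw [gainMap, qf_add, qf_add, qf_smul, qf_smul, qf_add, qf_conj_transpose, qf_conj_transpose,
    qf_mul_transpose_self]

theorem gainMap_observerGain (hP : P.PosSemidef) :
    gainMap A C ρ Q (observerGain A C P) P = mareMap A C ρ Q P := by
  rw [gainMap_eq A C ρ Q _ hP, sub_self, Matrix.zero_mul, Matrix.zero_mul, smul_zero, add_zero]

theorem qf_mareMap_le (hρ : ρ ≤ 1) (L : Matrix (Fin n) (Fin q) ℝ) (hP : P.PosSemidef)
    (x : Fin n → ℝ) : qf (mareMap A C ρ Q P) x ≤ qf (gainMap A C ρ Q L P) x := by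
  rw [gainMap_eq A C ρ Q L hP, qf_add, qf_smul, qf_conj_transpose]
  exact le_add_of_nonneg_right (mul_nonneg (by linarith)
    (qf_nonneg (posDef_innovation hP).posSemidef _))

theorem isSymm_gainMap (hQ : Q.IsSymm) (L : Matrix (Fin n) (Fin q) ℝ) (hP : P.IsSymm) :
    (gainMap A C ρ Q L P).IsSymm := by
  simp only [Matrix.IsSymm, gainMap, Matrix.transpose_add, Matrix.transpose_smul,
    Matrix.transpose_mul, Matrix.transpose_transpose, hQ.eq, hP.eq, Matrix.mul_assoc]

theorem posSemidef_of_isSymm {M : Matrix (Fin n) (Fin n) ℝ} (hM : M.IsSymm)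
    (h : ∀ x, 0 ≤ qf M x) : M.PosSemidef :=
  posSemidef_of_qf_nonneg
    (by rw [Matrix.IsHermitian, Matrix.conjTranspose_eq_transpose_of_trivial, hM.eq]) h

theorem qf_le_qf_mareMap (hρ0 : 0 ≤ ρ) (hρ : ρ ≤ 1) (hP : P.PosSemidef) (x : Fin n → ℝ) :
    qf Q x ≤ qf (mareMap A C ρ Q P) x := by
  rw [← gainMap_observerGain hP, qf_gainMap]
  have h1 := qf_nonneg hP (Aᵀ *ᵥ x)
  have h2 := qf_nonneg hP ((A + observerGain A C P * C)ᵀ *ᵥ x)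
  have h3 := nsq_nonneg ((observerGain A C P)ᵀ *ᵥ x)
  have h4 : 0 ≤ 1 - ρ := by linarith
  have : 0 ≤ ρ * qf P (Aᵀ *ᵥ x) + (1 - ρ) * (qf P ((A + observerGain A C P * C)ᵀ *ᵥ x) +
    nsq ((observerGain A C P)ᵀ *ᵥ x)) := by positivity
  linarith

theorem posSemidef_mareMap (hρ0 : 0 ≤ ρ) (hρ : ρ ≤ 1) (hQ : Q.PosSemidef) (hP : P.PosSemidef) :
    (mareMap A C ρ Q P).PosSemidef :=
  posSemidef_of_isSymm
    (by
      rw [← gainMap_observerGain hP]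
      exact isSymm_gainMap (isSymm_of_posSemidef hQ) _ (isSymm_of_posSemidef hP))
    fun x => (qf_nonneg hQ x).trans (qf_le_qf_mareMap hρ0 hρ hP x)

theorem qf_mareMap_mono (hρ0 : 0 ≤ ρ) (hρ : ρ ≤ 1) {P' : Matrix (Fin n) (Fin n) ℝ}
    (hP : P.PosSemidef) (hP' : P'.PosSemidef) (h : ∀ x, qf P x ≤ qf P' x) (x : Fin n → ℝ) :
    qf (mareMap A C ρ Q P) x ≤ qf (mareMap A C ρ Q P') x := by
  have h4 : 0 ≤ 1 - ρ := by linarith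
  refine (qf_mareMap_le hρ (observerGain A C P') hP x).trans ?_
  rw [← gainMap_observerGain hP', qf_gainMap, qf_gainMap]
  have h1 := h (Aᵀ *ᵥ x)
  have h2 := h ((A + observerGain A C P' * C)ᵀ *ᵥ x)
  gcongr

theorem continuousAt_mareMap (hP : P.PosSemidef) :
    ContinuousAt (mareMap A C ρ Q) P := by
  have hinv : ContinuousAt (fun X : Matrix (Fin n) (Fin n) ℝ => (C * X * Cᵀ + 1)⁻¹) P := by
    refine ContinuousAt.comp (g := Inv.inv) (continuousAt_matrix_inv _ ?_)
      (by fun_prop : Continuous fun X : Matrix (Fin n) (Fin n) ℝ => C * X * Cᵀ + 1).continuousAt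
    have h : (C * P * Cᵀ + 1).det ≠ 0 := (isUnit_det_innovation C hP).ne_zero
    rw [Ring.inverse_eq_inv']
    exact continuousAt_inv₀ h
  have hid : ContinuousAt (fun X : Matrix (Fin n) (Fin n) ℝ => X) P := continuousAt_id
  have hmul : ∀ {a b c : ℕ} {f : Matrix (Fin n) (Fin n) ℝ → Matrix (Fin a) (Fin b) ℝ}
      {g : Matrix (Fin n) (Fin n) ℝ → Matrix (Fin b) (Fin c) ℝ}, ContinuousAt f P →
      ContinuousAt g P → ContinuousAt (fun X => f X * g X) P := fun hf hg =>
    ContinuousAt.comp (g := fun p : Matrix _ _ ℝ × Matrix _ _ ℝ => p.1 * p.2)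
      (by fun_prop : Continuous fun p : Matrix _ _ ℝ × Matrix _ _ ℝ => p.1 * p.2).continuousAt
      (hf.prodMk hg)
  have h1 := hmul (hmul (hmul (hmul (hmul (hmul (continuousAt_const (y := A)) hid)
    (continuousAt_const (y := Cᵀ))) hinv) (continuousAt_const (y := C))) hid)
    (continuousAt_const (y := Aᵀ))
  have h2 := hmul (hmul (continuousAt_const (y := A)) hid) (continuousAt_const (y := Aᵀ))
  exact (h2.sub (h1.const_smul (1 - ρ))).add continuousAt_const

/-- If some gain `L` makes the covariance propagation contract in mean square, the iterates of the
Riccati map from zero increase and stay bounded, so they converge to a fixed point. The bound comes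
from `tr (Y P)`, which the propagation with gain `L` contracts up to a constant. -/
theorem exists_mareMap_fixed (hρ0 : 0 ≤ ρ) (hρ : ρ ≤ 1) (hQ : Q.PosDef)
    {L : Matrix (Fin n) (Fin q) ℝ} {Y : Matrix (Fin n) (Fin n) ℝ} (hY : Y.PosDef) {β : ℝ}
    (hβ0 : 0 < β) (hβ1 : β < 1)
    (h : ∀ x, ρ * qf Y (A *ᵥ x) + (1 - ρ) * qf Y ((A + L * C) *ᵥ x) ≤ β * qf Y x) :
    ∃ P : Matrix (Fin n) (Fin n) ℝ, P.PosDef ∧ P = mareMap A C ρ Q P := by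
  set p : ℕ → Matrix (Fin n) (Fin n) ℝ := fun k => (mareMap A C ρ Q)^[k] 0 with hp
  have hsucc : ∀ k, p (k + 1) = mareMap A C ρ Q (p k) := fun k =>
    Function.iterate_succ_apply' _ _ _
  have hpos : ∀ k, (p k).PosSemidef := fun k => by
    induction k with
    | zero => exact Matrix.PosSemidef.zero
    | succ k ih => rw [hsucc]; exact posSemidef_mareMap hρ0 hρ hQ.posSemidef ih
  have hmono : ∀ k x, qf (p k) x ≤ qf (p (k + 1)) x := fun k => by
    induction k with
    | zero =>
      intro x
      have : qf (p 0) x = 0 := by simp [hp, qf]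
      rw [this]
      exact qf_nonneg (hpos 1) x
    | succ k ih =>
      intro x
      rw [hsucc (k + 1)]
      conv_lhs => rw [hsucc k]
      exact qf_mareMap_mono hρ0 hρ (hpos k) (hpos (k + 1)) ih x
  have hYs := isSymm_of_posSemidef hY.posSemidef
  set d := (Y * ((1 - ρ) • (L * Lᵀ) + Q)).trace with hd
  have htr : ∀ k, (Y * p (k + 1)).trace ≤ β * (Y * p k).trace + d := fun k => by
    have h1 : (Y * p (k + 1)).trace ≤ (Y * gainMap A C ρ Q L (p k)).trace := by
      rw [Matrix.trace_mul_comm Y, Matrix.trace_mul_comm Y]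
      refine trace_mul_le_of_qf_le (isSymm_of_posSemidef (hpos _))
        (isSymm_gainMap (isSymm_of_posSemidef hQ.posSemidef) L (isSymm_of_posSemidef (hpos k)))
        (fun x => ?_) hY.posSemidef
      rw [hsucc]
      exact qf_mareMap_le hρ L (hpos k) x
    set N := ρ • (Aᵀ * Y * A) + (1 - ρ) • ((A + L * C)ᵀ * Y * (A + L * C)) with hN
    have h2 : (Y * gainMap A C ρ Q L (p k)).trace = (N * p k).trace + d := by
      have hcyc : ∀ T : Matrix (Fin n) (Fin n) ℝ,
          (Y * (T * p k * Tᵀ)).trace = (Tᵀ * Y * T * p k).trace := fun T => by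
        rw [← Matrix.mul_assoc, Matrix.trace_mul_comm]
        simp only [Matrix.mul_assoc]
      rw [hd, gainMap, hN, smul_add]
      generalize A + L * C = F
      simp only [Matrix.mul_add, Matrix.add_mul, Matrix.mul_smul, Matrix.smul_mul,
        Matrix.trace_add, Matrix.trace_smul, hcyc]
      ring
    have h3 : (N * p k).trace ≤ ((β • Y) * p k).trace := by
      refine trace_mul_le_of_qf_le ?_ (hYs.smul β) (fun x => ?_) (hpos k)
      · simp only [Matrix.IsSymm, hN, Matrix.transpose_add, Matrix.transpose_smul,
          Matrix.transpose_mul, Matrix.transpose_transpose, hYs.eq, Matrix.mul_assoc]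
      · rw [hN, qf_add, qf_smul, qf_smul, qf_smul]
        simp only [← Matrix.conjTranspose_eq_transpose_of_trivial, qf_conj]
        exact h x
    rw [Matrix.smul_mul, Matrix.trace_smul, smul_eq_mul] at h3
    linarith
  have hd0 : 0 ≤ d := by
    have h1 := htr 0
    have h2 := trace_mul_nonneg hY.posSemidef (hpos 1)
    have h3 : (Y * p 0).trace = 0 := by simp [hp]
    rw [h3] at h1
    linarith
  have hbd : ∀ k, (Y * p k).trace ≤ d / (1 - β) := fun k => by
    have h1β : 0 < 1 - β := by linarith
    induction k with
    | zero =>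
      have h3 : (Y * p 0).trace = 0 := by simp [hp]
      rw [h3]
      positivity
    | succ k ih =>
      refine (htr k).trans ?_
      calc β * (Y * p k).trace + d ≤ β * (d / (1 - β)) + d := by gcongr
        _ = d / (1 - β) := by
          field_simp
          ring
  have hbdd : ∀ x, ∃ c, ∀ k, qf (p k) x ≤ c := fun x => by
    have hxx : (Matrix.vecMulVec x x).PosSemidef := by
      simpa using Matrix.posSemidef_vecMulVec_self_star x
    obtain ⟨κ, hκ, hκle⟩ := exists_qf_le_mul (fun y hy => qf_pos hY hy) (Matrix.vecMulVec x x)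
    refine ⟨κ * (d / (1 - β)), fun k => ?_⟩
    have h1 : (Matrix.vecMulVec x x * p k).trace ≤ ((κ • Y) * p k).trace :=
      trace_mul_le_of_qf_le (isSymm_of_posSemidef hxx) (hYs.smul κ)
        (fun y => by rw [qf_smul]; exact hκle y) (hpos k)
    have h2 : (Matrix.vecMulVec x x * p k).trace = qf (p k) x := by
      rw [Matrix.trace_mul_comm, Matrix.mul_vecMulVec, Matrix.trace_vecMulVec, qf_real,
        dotProduct_comm]
    rw [h2, Matrix.smul_mul, Matrix.trace_smul, smul_eq_mul] at h1
    exact h1.trans (mul_le_mul_of_nonneg_left (hbd k) hκ.le)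
  obtain ⟨X, hX⟩ := exists_tendsto_of_qf_mono (fun k => isSymm_of_posSemidef (hpos k)) hmono hbdd
  have hXs : X.IsSymm := by
    have h1 : Filter.Tendsto (fun k => (p k)ᵀ) Filter.atTop (nhds Xᵀ) :=
      ((by fun_prop : Continuous fun M : Matrix (Fin n) (Fin n) ℝ => Mᵀ).tendsto X).comp hX
    simp only [fun k => (isSymm_of_posSemidef (hpos k)).eq] at h1
    exact tendsto_nhds_unique h1 hX
  have hXp : X.PosSemidef := posSemidef_of_isSymm hXs fun x => by
    have h1 : Continuous fun M : Matrix (Fin n) (Fin n) ℝ => qf M x := by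
      exact RCLike.continuous_re.comp
        (by fun_prop : Continuous fun M : Matrix (Fin n) (Fin n) ℝ => star x ⬝ᵥ (M *ᵥ x))
    exact ge_of_tendsto' ((h1.tendsto X).comp hX) fun k => qf_nonneg (hpos k) x
  have hfix : X = mareMap A C ρ Q X := by
    have h1 := (continuousAt_mareMap (A := A) (C := C) (ρ := ρ) (Q := Q) hXp).tendsto.comp hX
    refine tendsto_nhds_unique ?_ h1
    have h2 := hX.comp (Filter.tendsto_add_atTop_nat 1)
    exact h2.congr hsucc
  refine ⟨X, posDef_of_qf_pos hXp.isHermitian fun x hx => ?_, hfix⟩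
  rw [hfix]
  exact (qf_pos hQ hx).trans_le (qf_le_qf_mareMap hρ0 hρ hXp x)

/-- Comparison of two fixed points: the excess of `P'` over `P` is propagated by the gain belonging
to `P`, which contracts `P`. -/
theorem qf_le_of_mareMap_fixed (hρ0 : 0 ≤ ρ) (hρ : ρ ≤ 1) (hQ : Q.PosDef)
    {P' : Matrix (Fin n) (Fin n) ℝ} (hP : P.PosDef) (hP' : P'.PosDef)
    (h : P = mareMap A C ρ Q P) (h' : P' = mareMap A C ρ Q P') (x : Fin n → ℝ) :
    qf P' x ≤ qf P x := by
  set L := observerGain A C P with hL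
  have hρ' : 0 ≤ 1 - ρ := by linarith
  have e1 : ∀ x, qf P x = qf (gainMap A C ρ Q L P) x := fun x => by
    rw [hL, gainMap_observerGain hP.posSemidef, ← h]
  have e2 : ∀ x, qf P' x ≤ qf (gainMap A C ρ Q L P') x := fun x => by
    conv_lhs => rw [h']
    exact qf_mareMap_le hρ L hP'.posSemidef x
  simp only [qf_gainMap] at e1 e2
  obtain ⟨c, hc0, hc1, hc⟩ := exists_qf_le_contraction (qf_nonneg hP.posSemidef)
    (N := ρ • (A * P * Aᵀ) + (1 - ρ) • ((A + L * C) * P * (A + L * C)ᵀ)) fun x hx => by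
      rw [qf_add, qf_smul, qf_smul, qf_conj_transpose, qf_conj_transpose]
      have h0 := e1 x
      have h1 := qf_pos hQ hx
      have h2 := mul_nonneg hρ' (nsq_nonneg (Lᵀ *ᵥ x))
      linarith
  simp only [qf_add, qf_smul, qf_conj_transpose] at hc
  obtain ⟨t, ht, hle⟩ := exists_qf_le_mul (fun x hx => qf_pos hP hx) (P' - P)
  have key : ∀ (k : ℕ) x, qf P' x - qf P x ≤ t * c ^ k * qf P x := fun k => by
    induction k with
    | zero =>
      intro x
      have := hle x
      rwa [qf_sub, ← mul_one t, ← pow_zero c] at this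
    | succ k ih =>
      intro x
      have h0 := e1 x
      have h1 := e2 x
      have h2 := mul_le_mul_of_nonneg_left (ih (Aᵀ *ᵥ x)) hρ0
      have h3 := mul_le_mul_of_nonneg_left (ih ((A + L * C)ᵀ *ᵥ x)) hρ'
      have h4 : 0 ≤ t * c ^ k := by positivity
      have h5 := mul_le_mul_of_nonneg_left (hc x) h4
      calc qf P' x - qf P x ≤ ρ * (qf P' (Aᵀ *ᵥ x) - qf P (Aᵀ *ᵥ x)) +
            (1 - ρ) * (qf P' ((A + L * C)ᵀ *ᵥ x) - qf P ((A + L * C)ᵀ *ᵥ x)) := by linarith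
        _ ≤ t * c ^ k * (c * qf P x) := by linarith
        _ = t * c ^ (k + 1) * qf P x := by ring
  have hlim : Filter.Tendsto (fun k => t * c ^ k * qf P x) Filter.atTop (nhds (t * 0 * qf P x)) :=
    ((tendsto_pow_atTop_nhds_zero_of_lt_one hc0.le hc1).const_mul t).mul_const _
  rw [mul_zero, zero_mul] at hlim
  exact sub_nonpos.1 (ge_of_tendsto' hlim fun k => key k x)

theorem existsUnique_isMARESolution {δ : ℝ} (hdet : Detectable A C) (hδ0 : 0 < δ) (hδ1 : δ < 1)
    (hδA : δ * unstableProduct A < 1) (hQ : Q.PosDef) :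
    ∃! P : Matrix (Fin n) (Fin n) ℝ, IsMARESolution A C δ Q P := by
  have hρ0 : 0 < δ ^ 2 := by positivity
  have hρ1 : δ ^ 2 < 1 := pow_lt_one₀ hδ0.le hδ1 two_ne_zero
  have hρA : δ ^ 2 * unstableProduct A ^ 2 < 1 := by
    rw [← mul_pow]
    have := one_le_unstableProduct A
    exact pow_lt_one₀ (by positivity) hδA two_ne_zero
  obtain ⟨L, Y, hY, β, hβ0, hβ1, h⟩ := exists_meanSquare_contraction hdet hρ0 hρ1 hρA
  obtain ⟨P, hP, hfix⟩ := exists_mareMap_fixed hρ0.le hρ1.le hQ hY hβ0 hβ1 h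
  refine ⟨P, ⟨hP, hfix⟩, fun P' hP' => ?_⟩
  have heq : ∀ x, qf P' x = qf P x := fun x => le_antisymm
    (qf_le_of_mareMap_fixed hρ0.le hρ1.le hQ hP hP'.1 hfix hP'.2 x)
    (qf_le_of_mareMap_fixed hρ0.le hρ1.le hQ hP'.1 hP hP'.2 hfix x)
  ext i j
  rw [apply_eq_of_isSymm (isSymm_of_posSemidef hP.posSemidef),
    apply_eq_of_isSymm (isSymm_of_posSemidef hP'.1.posSemidef)]
  simp only [heq]

end Riccati

/-! ### The consensus region -/

section ConsensusRegion

variable {n q : ℕ}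

theorem cplx_sub {m n : ℕ} (M N : Matrix (Fin m) (Fin n) ℝ) : cplx (M - N) = cplx M - cplx N :=
  Matrix.map_sub _ Complex.ofReal_sub M N

theorem cplx_smul {m n : ℕ} (r : ℝ) (M : Matrix (Fin m) (Fin n) ℝ) :
    cplx (r • M) = (r : ℂ) • cplx M := by
  ext i j
  simp [cplx]

theorem closedBall_subset_consensusRegion {A : Matrix (Fin n) (Fin n) ℝ}
    {C : Matrix (Fin q) (Fin n) ℝ} {Q P : Matrix (Fin n) (Fin n) ℝ} {δ : ℝ}
    (hQ : Q.PosDef) (hP : IsMARESolution A C δ Q P) :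
    Metric.closedBall (0 : ℂ) δ ⊆ consensusRegion A C (observerGain A C P) := by
  intro σ hσ
  rw [mem_closedBall_zero_iff] at hσ
  obtain ⟨hPd, hfix⟩ := hP
  have hPs := isSymm_of_posSemidef hPd.posSemidef
  have hcorr := correction_eq A C hPd.posSemidef
  have hW := observerGain_mul_innovation A C hPd.posSemidef
  set L := observerGain A C P with hL
  rw [hcorr] at hfix
  set M := L * (C * P * Cᵀ + 1) * Lᵀ with hM
  have hMs : Mᵀ = M := by
    simp only [hM, Matrix.transpose_mul, Matrix.transpose_add, Matrix.transpose_one,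
      Matrix.transpose_transpose, hPs.eq, Matrix.mul_assoc]
  have h1 : A * P * (L * C)ᵀ = -M := by
    rw [hM, hW, Matrix.transpose_mul, Matrix.neg_mul, neg_neg, Matrix.mul_assoc (A * P)]
  have h2 : L * C * P * Aᵀ = -M := by
    have := congrArg Matrix.transpose h1
    rw [Matrix.transpose_neg, hMs, Matrix.transpose_mul, Matrix.transpose_transpose,
      Matrix.transpose_mul A, hPs.eq, ← Matrix.mul_assoc] at this
    exact this
  have h3 : L * C * P * (L * C)ᵀ = M - L * Lᵀ := by
    rw [hM, Matrix.mul_add, Matrix.mul_one, Matrix.add_mul, add_sub_cancel_right,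
      Matrix.transpose_mul]
    simp only [Matrix.mul_assoc]
  set s : ℂ := 1 - σ with hs
  have hsσ : 2 * s.re - ‖s‖ ^ 2 = 1 - ‖σ‖ ^ 2 := by
    rw [← Complex.normSq_eq_norm_sq, ← Complex.normSq_eq_norm_sq, Complex.normSq_apply,
      Complex.normSq_apply, hs]
    simp only [Complex.sub_re, Complex.sub_im, Complex.one_re, Complex.one_im]
    ring
  have hid : (cplx A + s • cplx (L * C)) * cplx P * (cplx A + s • cplx (L * C))ᴴ =
      cplx (A * P * Aᵀ - (1 - ‖σ‖ ^ 2) • M - ‖s‖ ^ 2 • (L * Lᵀ)) := by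
    have e1 : (cplx A + s • cplx (L * C)) * cplx P * (cplx A + s • cplx (L * C))ᴴ =
        cplx (A * P * Aᵀ) + star s • cplx (A * P * (L * C)ᵀ) + s • cplx (L * C * P * Aᵀ) +
          (star s * s) • cplx (L * C * P * (L * C)ᵀ) := by
      rw [Matrix.conjTranspose_add, Matrix.conjTranspose_smul, ← cplx_transpose, ← cplx_transpose]
      simp only [cplx_mul, Matrix.add_mul, Matrix.mul_add, Matrix.smul_mul, Matrix.mul_smul]
      module
    have e2 : star s * s = ((‖s‖ ^ 2 : ℝ) : ℂ) := by
      rw [Complex.star_def, Complex.conj_mul']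
      norm_cast
    have e3 : star s + s = ((2 * s.re : ℝ) : ℂ) := by
      rw [Complex.star_def, add_comm, Complex.add_conj]
    have e4 : cplx (-M) = -cplx M := by
      ext i j
      simp [cplx]
    rw [e1, h1, h2, h3, e2, cplx_sub, cplx_sub, cplx_sub, cplx_smul, cplx_smul, ← hsσ, e4,
      Complex.ofReal_sub, ← e3]
    module
  refine schurStable_of_qf_lt (X := cplx P) (fun z => ?_) fun z hz => ?_
  · rw [qf_cplx]
    exact add_nonneg (qf_nonneg hPd.posSemidef _) (qf_nonneg hPd.posSemidef _)
  · rw [hid, qf_cplx, qf_cplx]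
    -- it suffices to compare real forms, at the real and imaginary parts of `z`
    have key : ∀ u : Fin n → ℝ,
        qf (A * P * Aᵀ - (1 - ‖σ‖ ^ 2) • M - ‖s‖ ^ 2 • (L * Lᵀ)) u ≤ qf P u - qf Q u := by
      intro u
      have e1 : qf P u = qf (A * P * Aᵀ) u - (1 - δ ^ 2) * qf M u + qf Q u := by
        conv_lhs => rw [hfix]
        rw [qf_add, qf_sub, qf_smul]
      have e2 : 0 ≤ qf M u := by
        rw [hM, qf_conj_transpose]
        exact qf_nonneg (posDef_innovation hPd.posSemidef).posSemidef _
      have e3 : 0 ≤ qf (L * Lᵀ) u := by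
        rw [qf_mul_transpose_self]
        exact nsq_nonneg _
      have e4 : ‖σ‖ ^ 2 ≤ δ ^ 2 := pow_le_pow_left₀ (norm_nonneg _) hσ 2
      have e5 : 0 ≤ ‖s‖ ^ 2 * qf (L * Lᵀ) u := by positivity
      rw [qf_sub, qf_sub, qf_smul, qf_smul]
      nlinarith [mul_le_mul_of_nonneg_right e4 e2]
    have k1 := key fun i => (z i).re
    have k2 := key fun i => (z i).im
    have hQpos : 0 < qf Q (fun i => (z i).re) + qf Q (fun i => (z i).im) := by
      by_cases h0 : (fun i => (z i).re) = 0
      · have h0' : (fun i => (z i).im) ≠ 0 := fun h => hz <| funext fun i =>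
          Complex.ext (congrFun h0 i) (congrFun h i)
        exact add_pos_of_nonneg_of_pos (qf_nonneg hQ.posSemidef _) (qf_pos hQ h0')
      · exact add_pos_of_pos_of_nonneg (qf_pos hQ h0) (qf_nonneg hQ.posSemidef _)
    linarith

end ConsensusRegion

/-! ### Row-stochastic matrices of graphs with a spanning tree -/

section StochasticMatrix

variable {N : ℕ} {G : Digraph (Fin N)} {D : Matrix (Fin N) (Fin N) ℝ}

theorem IsRowStochasticFor.nonneg (hD : IsRowStochasticFor G D) (i j : Fin N) : 0 ≤ D i j := by
  classical
  by_cases hij : i = j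
  · rw [hij]
    exact (hD.diag_pos j).le
  · by_cases h : G.Adj j i
    · exact (hD.edge_pos i j hij h).le
    · rw [hD.nonedge_zero i j hij h]

theorem IsRowStochasticFor.mulVec_eq (hD : IsRowStochasticFor G D) (x : Fin N → ℝ) (i : Fin N) :
    x i - (D *ᵥ x) i = ∑ j, D i j * (x i - x j) := by
  simp only [Matrix.mulVec, dotProduct, mul_sub, Finset.sum_sub_distrib, ← Finset.sum_mul,
    hD.row_sum, one_mul]

theorem IsRowStochasticFor.sub_mulVec_nonneg (hD : IsRowStochasticFor G D) {x : Fin N → ℝ}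
    {i : Fin N} (hi : ∀ j, x j ≤ x i) : 0 ≤ x i - (D *ᵥ x) i := by
  rw [hD.mulVec_eq]
  exact Finset.sum_nonneg fun j _ => mul_nonneg (hD.nonneg i j) (sub_nonneg.2 (hi j))

/-- Maximum principle: a harmonic function attains its maximum at the root. -/
theorem IsRowStochasticFor.le_root (hD : IsRowStochasticFor G D) {r : Fin N}
    (hr : ∀ i, Relation.ReflTransGen G.Adj r i) {x : Fin N → ℝ} (hx : D *ᵥ x = x) (j : Fin N) :
    x j ≤ x r := by
  have : Nonempty (Fin N) := ⟨r⟩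
  obtain ⟨i, hi⟩ := Finite.exists_max x
  have hstep : ∀ a c, G.Adj a c → x c = x i → x a = x i := by
    intro a c hac hc
    by_cases h : c = a
    · rw [← h, hc]
    have h0 : ∑ j, D c j * (x c - x j) = 0 := by rw [← hD.mulVec_eq, hx, sub_self]
    have h1 := (Finset.sum_eq_zero_iff_of_nonneg fun j _ =>
      mul_nonneg (hD.nonneg c j) (sub_nonneg.2 (hc ▸ hi j))).1 h0 a (Finset.mem_univ a)
    have h2 := (mul_eq_zero.1 h1).resolve_left (hD.edge_pos c a h hac).ne'
    linarith
  have hri : x r = x i := by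
    refine Relation.ReflTransGen.head_induction_on (hr i)
      (motive := fun a _ => x a = x i) rfl fun {a c} hac _ hc => hstep a c hac hc
  rw [hri]
  exact hi j

/-- The eigenvalue one is algebraically simple: the only left fixed vector with zero sum is zero.
Indeed `x ↦ x - D x + x r` is injective, hence onto, and such a vector annihilates its range. -/
theorem IsRowStochasticFor.eq_zero_of_vecMul_eq (hD : IsRowStochasticFor G D)
    (hG : HasSpanningTree G) {w : Fin N → ℝ} (hw : w ᵥ* D = w) (hw0 : ∑ i, w i = 0) : w = 0 := by
  obtain ⟨r, hr⟩ := hG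
  have : Nonempty (Fin N) := ⟨r⟩
  let Φ : (Fin N → ℝ) →ₗ[ℝ] (Fin N → ℝ) := LinearMap.id - D.mulVecLin +
    LinearMap.pi fun _ => LinearMap.proj r
  have hΦ : ∀ x i, Φ x i = x i - (D *ᵥ x) i + x r := fun x i => rfl
  have hinj : Function.Injective Φ := by
    refine (injective_iff_map_eq_zero Φ).2 fun x hx => ?_
    have h0 : ∀ i, x i - (D *ᵥ x) i + x r = 0 := fun i => by rw [← hΦ, hx, Pi.zero_apply]
    obtain ⟨i, hi⟩ := Finite.exists_max x
    obtain ⟨j, hj⟩ := Finite.exists_min x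
    have h1 := hD.sub_mulVec_nonneg hi
    have h2 := hD.sub_mulVec_nonneg (x := -x) (i := j) fun k => neg_le_neg (hj k)
    rw [Matrix.mulVec_neg, Pi.neg_apply, Pi.neg_apply] at h2
    have hr0 : x r = 0 := by linarith [h0 i, h0 j]
    have hfix : D *ᵥ x = x := funext fun k => by linarith [h0 k]
    funext k
    have h3 := hD.le_root hr hfix k
    have h4 := hD.le_root hr (x := -x) (by rw [Matrix.mulVec_neg, hfix]) k
    rw [Pi.neg_apply, Pi.neg_apply] at h4
    rw [Pi.zero_apply]
    linarith
  obtain ⟨x, hx⟩ := (LinearMap.injective_iff_surjective.1 hinj) w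
  have hww : w ⬝ᵥ w = 0 := by
    have h1 : w = x - D *ᵥ x + fun _ => x r := by
      rw [← hx]
      rfl
    have h2 : w ⬝ᵥ (fun _ : Fin N => x r) = 0 := by
      rw [dotProduct, ← Finset.sum_mul, hw0, zero_mul]
    nth_rewrite 2 [h1]
    rw [dotProduct_add, dotProduct_sub, Matrix.dotProduct_mulVec, hw, sub_self, h2, add_zero]
  exact dotProduct_self_eq_zero.1 hww

end StochasticMatrix

/-! ### Consensus -/

section Consensus

open Filter Topology

variable {n q N : ℕ}

theorem sum_transpose_mulVec {D : Matrix (Fin N) (Fin N) ℂ} (hD : ∀ i, ∑ j, D i j = 1)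
    (w : Fin N → ℂ) : ∑ j, (Dᵀ *ᵥ w) j = ∑ i, w i := by
  simp only [Matrix.mulVec, dotProduct, Matrix.transpose_apply]
  rw [Finset.sum_comm]
  refine Finset.sum_congr rfl fun i _ => ?_
  rw [← Finset.sum_mul, hD, one_mul]

/-- Combinations of the agents with zero total weight decay. Along a generalized left eigenvector
of `D` for the eigenvalue `μ`, the combination is governed by `A + (1 - μ) M`, driven by
combinations that belong to generalized eigenvectors of lower rank. -/
theorem tendsto_sum_smul_zero {A M : Matrix (Fin n) (Fin n) ℂ} {D : Matrix (Fin N) (Fin N) ℂ}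
    (hD : ∀ i, ∑ j, D i j = 1)
    (hstab : ∀ (μ : ℂ) (w : Fin N → ℂ), w ≠ 0 → ∑ i, w i = 0 → Dᵀ *ᵥ w = μ • w →
      SchurStable (A + (1 - μ) • M))
    {e : ℕ → Fin N → Fin n → ℂ}
    (he : ∀ k i, e (k + 1) i = A *ᵥ e k i + M *ᵥ ∑ j, D i j • (e k i - e k j))
    (w : Fin N → ℂ) (hw : ∑ i, w i = 0) :
    Tendsto (fun k => ∑ i, w i • e k i) atTop (𝓝 0) := by
  let V : Submodule ℂ (Fin N → ℂ) := LinearMap.ker (∑ i, LinearMap.proj i : (Fin N → ℂ) →ₗ[ℂ] ℂ)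
  have hV : ∀ u, u ∈ V ↔ ∑ i, u i = 0 := fun u => by simp [V]
  have hTV : ∀ u ∈ V, (Dᵀ).mulVecLin u ∈ V := fun u hu => by
    rw [hV] at hu ⊢
    rw [Matrix.mulVecLin_apply, sum_transpose_mulVec hD, hu]
  set T : Module.End ℂ V := (Dᵀ).mulVecLin.restrict hTV with hT
  let z : (Fin N → ℂ) → ℕ → Fin n → ℂ := fun u k => ∑ i, u i • e k i
  have hz_add : ∀ u u', z (u + u') = z u + z u' := fun u u' => funext fun k => by
    simp [z, add_smul, Finset.sum_add_distrib]
  have hz_smul : ∀ (c : ℂ) u, z (c • u) = c • z u := fun c u => funext fun k => by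
    simp [z, Finset.smul_sum, mul_smul]
  have hz_step : ∀ u k, z u (k + 1) = A *ᵥ z u k + M *ᵥ (z u k - z (Dᵀ *ᵥ u) k) := by
    intro u k
    have h1 : z (Dᵀ *ᵥ u) k = ∑ i, u i • ∑ j, D i j • e k j := by
      simp only [z, Matrix.mulVec, dotProduct, Matrix.transpose_apply, Finset.sum_smul,
        Finset.smul_sum, smul_smul]
      rw [Finset.sum_comm]
      simp only [mul_comm]
    have h2 : ∀ i, ∑ j, D i j • (e k i - e k j) = e k i - ∑ j, D i j • e k j := fun i => by
      simp only [smul_sub, Finset.sum_sub_distrib, ← Finset.sum_smul, hD, one_smul]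
    rw [h1]
    simp only [z, he, h2]
    simp only [smul_add, Finset.sum_add_distrib, ← Matrix.mulVec_smul, ← Matrix.mulVec_sum,
      smul_sub, Finset.sum_sub_distrib]
  let S : Submodule ℂ V :=
    { carrier := {u | Tendsto (z u) atTop (𝓝 0)}
      add_mem' := fun {u u'} (hu : Tendsto (z u) atTop (𝓝 0))
          (hu' : Tendsto (z u') atTop (𝓝 0)) => by
        have := hu.add hu'
        rw [add_zero] at this
        change Tendsto (z (u + u')) atTop (𝓝 0)
        rw [hz_add]
        exact this
      zero_mem' := by
        have : z ((0 : V) : Fin N → ℂ) = fun _ => 0 := funext fun k => by simp [z]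
        rw [Set.mem_ofPred_eq, this]
        exact tendsto_const_nhds
      smul_mem' := fun c u (hu : Tendsto (z u) atTop (𝓝 0)) => by
        have := hu.const_smul c
        rw [smul_zero] at this
        change Tendsto (z (c • (u : Fin N → ℂ))) atTop (𝓝 0)
        rw [hz_smul]
        exact this }
  have hS : ∀ u : V, u ∈ S ↔ Tendsto (z u) atTop (𝓝 0) := fun u => Iff.rfl
  have hgen : ∀ (μ : ℂ) (k : ℕ) (u : V), ((T - algebraMap ℂ (Module.End ℂ V) μ) ^ k) u = 0 →
      u ∈ S := by
    intro μ k
    by_cases hμ : T.HasEigenvalue μ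
    · obtain ⟨y, hy⟩ := hμ.exists_hasEigenvector
      have hst := hstab μ y (fun h => hy.2 (Subtype.ext h)) ((hV _).1 y.2) (by
        have := congrArg Subtype.val hy.apply_eq_smul
        simpa [hT, Matrix.mulVec_transpose] using this)
      induction k with
      | zero =>
        intro u hu
        rw [pow_zero, Module.End.one_apply] at hu
        rw [hu]
        exact S.zero_mem
      | succ k ih =>
        intro u hu
        rw [pow_succ, Module.End.mul_apply] at hu
        set u' := (T - algebraMap ℂ (Module.End ℂ V) μ) u with hu'
        have h1 := (hS _).1 (ih u' hu)
        have h2 : Dᵀ *ᵥ (u : Fin N → ℂ) = μ • (u : Fin N → ℂ) + (u' : Fin N → ℂ) := by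
          have : T u = μ • u + u' := by
            rw [hu', LinearMap.sub_apply, Module.algebraMap_end_apply]
            abel
          have := congrArg Subtype.val this
          simpa [hT, Matrix.mulVec_transpose] using this
        refine (hS u).2 (hst.tendsto_zero (f := fun k => -(M *ᵥ z u' k)) (fun k => ?_) ?_)
        · rw [hz_step, h2, hz_add, hz_smul, Matrix.add_mulVec, Matrix.smul_mulVec, Pi.add_apply,
            Pi.smul_apply, ← sub_sub, Matrix.mulVec_sub, Matrix.mulVec_sub, Matrix.mulVec_smul,
            sub_smul, one_smul]
          abel
        · have hc : Continuous fun y : Fin n → ℂ => -(M *ᵥ y) := by fun_prop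
          simpa [Function.comp_def] using (hc.tendsto 0).comp h1
    · intro u hu
      have hinj : Function.Injective (T - algebraMap ℂ (Module.End ℂ V) μ) := by
        rw [← LinearMap.ker_eq_bot]
        rw [Module.End.hasEigenvalue_iff, not_not, Module.End.eigenspace_def] at hμ
        exact hμ
      have : Function.Injective ((T - algebraMap ℂ (Module.End ℂ V) μ) ^ k) := by
        rw [Module.End.coe_pow]
        exact hinj.iterate k
      rw [this (hu.trans (map_zero _).symm)]
      exact S.zero_mem
  have htop : (⊤ : Submodule ℂ V) ≤ S := by
    rw [← Module.End.iSup_maxGenEigenspace_eq_top T]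
    refine iSup_le fun μ u hu => ?_
    obtain ⟨k, hk⟩ := Module.End.mem_maxGenEigenspace T μ u |>.1 hu
    exact hgen μ k u (by simpa [Algebra.algebraMap_eq_smul_one] using hk)
  exact (hS ⟨w, (hV w).2 hw⟩).1 (htop Submodule.mem_top)

theorem cvec_add (x y : Fin n → ℝ) : cvec (x + y) = cvec x + cvec y := by
  ext i
  simp [cvec]

theorem cvec_sub (x y : Fin n → ℝ) : cvec (x - y) = cvec x - cvec y := by
  ext i
  simp [cvec]

theorem cvec_smul_sum {ι : Type*} [Fintype ι] (c : ι → ℝ) (x : ι → Fin n → ℝ) :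
    cvec (∑ j, c j • x j) = ∑ j, (c j : ℂ) • cvec (x j) := by
  ext i
  simp [cvec, Finset.sum_apply]

theorem continuous_cvec : Continuous (cvec : (Fin n → ℝ) → Fin n → ℂ) :=
  continuous_pi fun i => Complex.continuous_ofReal.comp (continuous_apply i)

theorem tendsto_zero_of_cvec {x : ℕ → Fin n → ℝ}
    (h : Tendsto (fun k => cvec (x k)) atTop (𝓝 0)) : Tendsto x atTop (𝓝 0) := by
  have hc : Continuous fun z : Fin n → ℂ => fun i => (z i).re := by fun_prop
  exact (hc.tendsto 0).comp h

/-- A zero-sum eigenvector of `Dᵀ` belongs to an eigenvalue other than one. -/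
theorem InGammaLe.norm_le {δ : ℝ} {G : Digraph (Fin N)} {D : Matrix (Fin N) (Fin N) ℝ}
    (h : InGammaLe δ G D) {μ : ℂ} {w : Fin N → ℂ} (hw : w ≠ 0) (hw0 : ∑ i, w i = 0)
    (hμ : (cplx D)ᵀ *ᵥ w = μ • w) : ‖μ‖ ≤ δ := by
  have hspec : μ ∈ spectrum ℂ (cplx D) := by
    rw [Matrix.mem_spectrum_iff_isRoot_charpoly, ← Matrix.charpoly_transpose,
      ← Matrix.mem_spectrum_iff_isRoot_charpoly]
    exact mem_spectrum_iff_exists_eigenvector.2 ⟨w, hw, hμ⟩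
  refine h.eigenvalues μ hspec fun h1 => hw ?_
  rw [h1, one_smul, Matrix.mulVec_transpose] at hμ
  have hpart : ∀ j, ∑ i, w i * (D i j : ℂ) = w j := fun j => congrFun hμ j
  have hre := h.rowStochastic.eq_zero_of_vecMul_eq h.spanningTree (w := fun i => (w i).re)
    (funext fun j => by
      have := congrArg Complex.re (hpart j)
      simpa [Matrix.vecMul, dotProduct] using this)
    (by simpa using congrArg Complex.re hw0)
  have him := h.rowStochastic.eq_zero_of_vecMul_eq h.spanningTree (w := fun i => (w i).im)
    (funext fun j => by
      have := congrArg Complex.im (hpart j)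
      simpa [Matrix.vecMul, dotProduct] using this)
    (by simpa using congrArg Complex.im hw0)
  exact funext fun i => Complex.ext (congrFun hre i) (congrFun him i)

theorem solvesConsensus_of_closedBall_subset {p : ℕ} {A : Matrix (Fin n) (Fin n) ℝ}
    {B : Matrix (Fin n) (Fin p) ℝ} {C : Matrix (Fin q) (Fin n) ℝ} {K : Matrix (Fin p) (Fin n) ℝ}
    {L : Matrix (Fin n) (Fin q) ℝ} {δ : ℝ} (hK : SchurStable (cplx (A + B * K)))
    (hL : Metric.closedBall (0 : ℂ) δ ⊆ consensusRegion A C L)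
    {G : Digraph (Fin N)} {D : Matrix (Fin N) (Fin N) ℝ} (hD : InGammaLe δ G D) :
    SolvesConsensus A B C K L D := by
  intro x v hxv i j
  -- the observation errors `v - x` evolve independently of the feedback gain
  set e : ℕ → Fin N → Fin n → ℝ := fun k i => v k i - x k i with he
  have hestep : ∀ k i, e (k + 1) i = A *ᵥ e k i + (L * C) *ᵥ ∑ j, D i j • (e k i - e k j) := by
    intro k i
    have h1 : (∑ j, D i j • (C *ᵥ (v k i - v k j))) - ∑ j, D i j • (C *ᵥ x k i - C *ᵥ x k j) =
        C *ᵥ ∑ j, D i j • (e k i - e k j) := by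
      rw [← Finset.sum_sub_distrib, Matrix.mulVec_sum]
      refine Finset.sum_congr rfl fun j _ => ?_
      rw [← smul_sub, Matrix.mulVec_smul]
      congr 1
      simp only [he, Matrix.mulVec_sub]
      abel
    have h2 := hxv k i
    rw [h1] at h2
    simp only [he] at h2 ⊢
    rw [h2.1, h2.2, Matrix.add_mulVec, Matrix.mulVec_sub, ← Matrix.mulVec_mulVec _ B K,
      ← Matrix.mulVec_mulVec _ L C]
    abel
  have hrow : ∀ i, ∑ j, cplx D i j = 1 := fun i => by
    have := congrArg Complex.ofReal (hD.rowStochastic.row_sum i)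
    simpa [cplx] using this
  have hecomb := tendsto_sum_smul_zero (A := cplx A) (M := cplx (L * C)) hrow
    (fun μ w hw hw0 hμ => hL (mem_closedBall_zero_iff.2 (hD.norm_le hw hw0 hμ)))
    (e := fun k i => cvec (e k i))
    (fun k i => by
      rw [hestep, cvec_add, ← cplx_mulVec_cvec, ← cplx_mulVec_cvec, cvec_smul_sum]
      simp only [cvec_sub, cplx, Matrix.map_apply])
    (Pi.single i 1 - Pi.single j 1) (by simp [Finset.sum_sub_distrib])
  have hediff : Tendsto (fun k => e k i - e k j) atTop (𝓝 0) := by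
    refine tendsto_zero_of_cvec (hecomb.congr fun k => ?_)
    simp [sub_smul, Finset.sum_sub_distrib, cvec_sub, Pi.single_apply, ite_smul]
  have hxdiff : Tendsto (fun k => x k i - x k j) atTop (𝓝 0) := by
    refine tendsto_zero_of_cvec (hK.tendsto_zero
      (f := fun k => cvec ((B * K) *ᵥ (e k i - e k j))) (fun k => ?_) ?_)
    · rw [cplx_mulVec_cvec, ← cvec_add, (hxv k i).1, (hxv k j).1]
      congr 1
      simp only [he, Matrix.add_mulVec, Matrix.mulVec_sub, ← Matrix.mulVec_mulVec]
      abel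
    · have hc : Continuous fun y : Fin n → ℝ => cvec ((B * K) *ᵥ y) :=
        continuous_cvec.comp (by fun_prop)
      have h0 : cvec ((B * K) *ᵥ (0 : Fin n → ℝ)) = 0 := by
        ext i
        simp [cvec]
      have := (hc.tendsto 0).comp hediff
      rwa [h0] at this
  have := ((PiLp.continuous_toLp 2 (fun _ : Fin n => ℝ)).tendsto 0).comp hxdiff
  simpa [Function.comp_def] using this.norm

end Consensus

end DiscreteConsensus

theorem theorem4 {n p q : ℕ} (A : Matrix (Fin n) (Fin n) ℝ) (B : Matrix (Fin n) (Fin p) ℝ)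
    (C : Matrix (Fin q) (Fin n) ℝ)
    (hstab : DiscreteConsensus.Stabilizable A B) (hdet : DiscreteConsensus.Detectable A C)
    (δ : ℝ) (hδ0 : 0 < δ)
    (hδ : ((∀ μ ∈ spectrum ℂ (DiscreteConsensus.cplx A), ‖μ‖ ≤ 1) ∧ δ < 1) ∨
      ((∃ μ ∈ spectrum ℂ (DiscreteConsensus.cplx A), 1 < ‖μ‖) ∧ B.rank = 1 ∧
        δ < 1 / DiscreteConsensus.unstableProduct A)) :
    (∃ K : Matrix (Fin p) (Fin n) ℝ,
      DiscreteConsensus.SchurStable (DiscreteConsensus.cplx (A + B * K))) ∧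
    ∀ Q : Matrix (Fin n) (Fin n) ℝ, Q.PosDef →
      (∃! P : Matrix (Fin n) (Fin n) ℝ, DiscreteConsensus.IsMARESolution A C δ Q P) ∧
      ∀ (P : Matrix (Fin n) (Fin n) ℝ) (K : Matrix (Fin p) (Fin n) ℝ),
        DiscreteConsensus.IsMARESolution A C δ Q P →
        DiscreteConsensus.SchurStable (DiscreteConsensus.cplx (A + B * K)) →
        Metric.closedBall (0 : ℂ) δ ⊆
          DiscreteConsensus.consensusRegion A C (DiscreteConsensus.observerGain A C P) ∧
        ∀ (N : ℕ) (G : Digraph (Fin N)) (D : Matrix (Fin N) (Fin N) ℝ),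
          DiscreteConsensus.InGammaLe δ G D →
          DiscreteConsensus.SolvesConsensus A B C K (DiscreteConsensus.observerGain A C P) D := by
  have hP1 := DiscreteConsensus.one_le_unstableProduct A
  have hδA : δ * DiscreteConsensus.unstableProduct A < 1 := by
    rcases hδ with ⟨hA, h⟩ | ⟨-, -, h⟩
    · rwa [DiscreteConsensus.unstableProduct_eq_one hA, mul_one]
    · rwa [lt_div_iff₀ (by linarith)] at h
  have hδ1 : δ < 1 := (le_mul_of_one_le_right hδ0.le hP1).trans_lt hδA
  refine ⟨hstab, fun Q hQ => ⟨DiscreteConsensus.existsUnique_isMARESolution hdet hδ0 hδ1 hδA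
    hQ, fun P K hP hK => ?_⟩⟩
  have hregion := DiscreteConsensus.closedBall_subset_consensusRegion hQ hP
  exact ⟨hregion, fun N G D hD =>
    DiscreteConsensus.solvesConsensus_of_closedBall_subset hK hregion hD⟩
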